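/- **Conventions.** $\lambda$-terms (and the elementary terms below) are taken up to $\alpha$-equivalence. Simple types are $\sigma::=o\mid\sigma\to\sigma$. EAL formulas are $A::=o\mid A\multimap A\mid\,!A$. A *general EAL-type* is $\Theta::=\,!^{e}o\mid\,!^{e}(\Theta\multimap\Theta)$, where $e=n_1+\dots+n_k$ ($k\ge0$) is a formal sum of variables ranging over $\mathbb N$, and $!^{n}!^{e}\Theta$ is identified with $!^{n+e}\Theta$. A *linear constraint* is $\sum\pm n_i=0$ or $\sum n_i\ge1$. An integer solution $X$ assigns a natural number to each variable; $X(\Theta)$ and $X(B)$ are the instantiations. A *slice* is a set of critical points, i.e. of pairs (constraint $A^j$, list of free variable occurrences); an occurrence belongs to a slice $sl$ if it is in one of the lists of $sl$, a constraint belongs to $sl$ if it is the first component of one of its pairs. Constraints are referred to as rows of the system, so that a slice always refers to the current form of its constraints. $\mathrm{FVO}(M)$ is the list of free variable occurrences of $M$. **The algorithm.** The input is a simple type derivation (in natural deduction) of $M:\sigma$; all variables introduced are fresh. * $\mathcal P(o)=\,!^po$, $\ \mathcal P(\sigma\to\tau)=\,!^p(\mathcal P(\sigma)\multimap\mathcal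 P(\tau))$. * $\mathcal U(\Theta_1,\dots,\Theta_h)$, for types of the same shape, equates corresponding exponents of consecutive types: $e_i-e_{i+1}=0$ at every position. * $\mathcal C(\Theta)=\emptyset$; for $k\ge2$, $\mathcal C(!^e\Theta_1,\dots,\Theta_k)$ is $\{e\ge1\}\cup\mathcal U(!^e\Theta_1,\dots,\Theta_k)$. * *Boxing.* $\mathbb B(M,B,\Gamma,cpts,A)$ is $\langle B,\Gamma,A\rangle$ if $M$ is a variable. Otherwise, for each slice $sl\in cpts$ successively, take a fresh $c$, replace $\Gamma$ by $!^c\Gamma$, replace $\Theta$ by $!^c\Theta$ for every occurrence $x:\Theta$ of the base not in $sl$, and replace every constraint $A^j\in sl$, of the form $s=0$, by $s-c=0$; finally, put $!^b$, $b$ fresh, in front of $\Gamma$ and of every type of the base. * *Product union.* $S\Cup T=S\cup T\cup\{s\cup t: s\in S,t\in T\}$. * $\mathcal S(M:\sigma)=\langle\Theta,B,A,cpts\rangle$ is defined by recursion, where the base $B$ is a multiset with one element for each free variable occurrence: * $\mathcal S(x:\sigma)=\langle\Theta,\{x:\Theta\},\emptyset,\emptyset\rangle$ with $\Theta=\mathcal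 P(\sigma)$. * $\lambda x.M:\sigma\to\tau$. Let $\mathcal S(M:\tau)=\langle\Gamma_1,B_1,A_1,cpts\rangle$ and $\mathbb B(M,B_1,\Gamma_1,cpts,A_1)=\langle B',\Gamma,A\rangle$. If $x\in\mathrm{FV}(M)$ and $B'=B\cup\{x:\Theta_1,\dots,x:\Theta_h\}$, with $x$ not in $B$, the result is $\langle\Theta_1\multimap\Gamma,B,A\cup\mathcal C(\Theta_1,\dots,\Theta_h),cpts'\rangle$, where $cpts'$ is $cpts$ without the slices to which an occurrence of $x$ belongs. If $x\notin\mathrm{FV}(M)$ and $M$ is an application, let $\Gamma=\,!^{e}\Delta$ with $e$ its whole outermost exponent; the result is $\langle\mathcal P(\sigma)\multimap\,!^n\Delta,\,B',\,A\cup\{e-n=0\},\,cpts\cup\{\{(e-n=0,\mathrm{FVO}(M))\}\}\rangle$, $n$ fresh. Otherwise the result is $\langle\mathcal P(\sigma)\multimap\Gamma,B',A,cpts\rangle$. * $(M\,N):\tau$ with $M:\sigma\to\tau$, $N:\sigma$. Let $\mathcal S(M)=\langle!^{e}(\Theta_1\multimap\Gamma),B_1,A_1,cpts_1\rangle$, $\mathcal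 S(N)=\langle\Theta_2,B_2,A_2,cpts_2\rangle$, $\mathbb B(N,B_2,\Theta_2,cpts_2,A_2)=\langle B_3,\Theta_3,A_3\rangle$, and let $A_4=\mathcal U(\Theta_3,\Theta_1)$ if $N$ is an application, $A_4=\mathcal U(\Theta_1,\Theta_3)$ otherwise. The result is $\langle\Gamma,B_1\cup B_3,A_1\cup A_3\cup A_4\cup\{e=0\},cpts_1'\Cup cpts_2'\rangle$, where $cpts_1'$ is $cpts_1$, together with the slice $\{(e=0,\mathrm{FVO}(M))\}$ if $M$ is an application, and $cpts_2'$ is $cpts_2$, together with the slice $\{(A_4^1,\mathrm{FVO}(N))\}$ if $N$ is an application; $A_4^1$ is the constraint between the outermost exponents. * *Top level.* $\mathscr S(M:\sigma)=\langle\Theta,B,A\rangle$: apply $\mathcal S$, then $\mathbb B$ to its result; $\Theta$ is the type so obtained; for each free variable $x$ of $M$, with types $\Theta_1,\dots,\Theta_k$ in the base so obtained, $B$ contains $x:\Theta_1$; $A$ consists of the constraints so obtained and of all the $\mathcal C(\Theta_1,\dots,\Theta_k)$. **Elementary terms and NEAL.** Elementary terms are $P::=x\mid\lambda x.P\mid(P\,P)\mid\,!(P)[P_1/x_1,\dots,P_n/x_n]\mid[P]_{Q/x,y}$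 ($n\ge 0$; the $x_i$, resp. $x,y$, are bound in $P$). $P^*$ is the $\lambda$-term obtained by performing the substitutions: $(!(P)[P_i/x_i])^*=P^*\{P_i^*/x_i\}$, $([P]_{Q/x,y})^*=P^*\{Q^*/x,Q^*/y\}$, homomorphic otherwise. *EAL-terms* are the legal elementary terms, i.e. those in which the parts $M,N$ of each application, the $P_i$ of each box, and $Q$ and $\lambda x.\lambda y.P$ for each contraction $[P]_{Q/x,y}$ have pairwise disjoint sets of free variables, and $\mathrm{FV}(P)=\{x_1,\dots,x_n\}$ for each box $!(P)[P_i/x_i]$. The judgement $\Gamma\vdash_{\mathsf{NEAL}}P:A$ ($\Gamma$ a base giving at most one formula to each variable) is generated by the following rules, where bases separated by commas have disjoint domains: $\Gamma,x:A\vdash x:A$; from $\Gamma,x:A\vdash M:B$ infer $\Gamma\vdash\lambda x.M:A\multimap B$; from $\Gamma\vdash M:A\multimap B$ and $\Delta\vdash N:A$ infer $\Gamma,\Delta\vdash(M\,N):B$; from $\Gamma\vdash M:\,!A$ and $\Delta,x:!A,y:!A\vdash N:B$ infer $\Gamma,\Delta\vdash[N]_{M/x,y}:B$; from $\Delta_i\vdash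 M_i:\,!A_i$ ($1\le i\le n$) and $x_1:A_1,\dots,x_n:A_n\vdash N:B$ infer $\Gamma,\Delta_1,\dots,\Delta_n\vdash\,!(N)[M_1/x_1,\dots,M_n/x_n]:\,!B$. The length $L$ counts abstractions and applications. An EAL-term $P$ is a *candidate* if (1) no subterm of $P$ has one of the forms $[N]_{!(M)[\dots]/x,y}$, $\;!(M)[\dots,{!(N)[\dots]}/x_i,\dots]$, $\;([M]_{Q/x,y}\ N)$, $\;(M\ [N]_{Q/x,y})$, $\;!(M)[\dots,[N]_{Q/y,z}/x_i,\dots]$, $\;[M]_{[N]_{Q/y,z}/x,y'}$, or $\lambda x.[M]_{N/y,z}$ with $x\notin\mathrm{FV}(N)$ (that is, $P$ is normal for all the reduction rules other than $\beta$); (2) $P$ is simple: $Q^*$ is a variable for every subterm $[R]_{Q/x,y}$ of $P$, and $L(P)=L(P^*)$; (3) $x,y\in\mathrm{FV}(R)$ for every subterm $[R]_{Q/x,y}$ of $P$; (4) $R$ is not a variable for every subterm $!(R)[\dots]$ of $P$. **Theorem (Soundness).** Let $M$ be a simply typed $\lambda$-term of type $\sigma$ and let $\mathscr S(M:\sigma)=\langle\Theta,B,A\rangle$.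 For every integer solution $X$ of $A$ there is a candidate EAL-term $P$ such that $P^*=M$ and $X(B)\vdash_{\mathsf{NEAL}}P:X(\Theta)$. -/

import Mathlib

namespace EAL

/-! ### Pure lambda terms, up to alpha-equivalence (de Bruijn indices) -/

/-- Pure lambda terms. An index that points above all enclosing binders is a free variable. -/
inductive Lam : Type
  | var (i : ℕ)
  | lam (M : Lam)
  | app (M N : Lam)

namespace Lam

def rename : (ℕ → ℕ) → Lam → Lam
  | ρ, var i => var (ρ i)
  | ρ, lam M => lam (rename (fun i => Nat.casesOn i 0 (fun j => ρ j + 1)) M)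
  | ρ, app M N => app (rename ρ M) (rename ρ N)

/-- Simultaneous capture-avoiding substitution of `s i` for the free variable `i`. -/
def subst : (ℕ → Lam) → Lam → Lam
  | s, var i => s i
  | s, lam M => lam (subst (fun i => Nat.casesOn i (var 0) (fun j => rename Nat.succ (s j))) M)
  | s, app M N => app (subst s M) (subst s N)

/-- The length: the number of abstractions and applications. -/
def length : Lam → ℕ
  | var _ => 0
  | lam M => 1 + length M
  | app M N => 1 + length M + length N

def isVar : Lam → Bool
  | var _ => true
  | _ => false

def isApp : Lam → Bool
  | app _ _ => true
  | _ => false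

end Lam

/-! ### Simple types and simple type derivations -/

/-- Simple types over the base type `o`. -/
inductive STy : Type
  | o
  | arr (σ τ : STy)

/-- Natural deduction derivations of `Γ ⊢ M : σ` in the simple type discipline, that is,
syntax trees of `M` decorated with simple types. -/
inductive SDer : List STy → Lam → STy → Type
  | var {Γ : List STy} {σ : STy} (i : ℕ) (h : Γ[i]? = some σ) : SDer Γ (Lam.var i) σ
  | lam {Γ : List STy} {σ τ : STy} {M : Lam} (d : SDer (σ :: Γ) M τ) :
      SDer Γ (Lam.lam M) (STy.arr σ τ)
  | app {Γ : List STy} {σ τ : STy} {M N : Lam}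
      (d : SDer Γ M (STy.arr σ τ)) (e : SDer Γ N σ) : SDer Γ (Lam.app M N) τ

/-! ### General EAL-types and linear constraints -/

/-- A formal sum `n₁ + ⋯ + n_k` of integer variables (the variables are named by numbers). -/
abbrev Expo := List ℕ

/-- General EAL-types: `base e` is `!^e o` and `arr e Θ Δ` is `!^e (Θ ⊸ Δ)`. -/
inductive GTy : Type
  | base (e : Expo)
  | arr (e : Expo) (Θ Δ : GTy)

namespace GTy

/-- The exponent of the outermost modality. -/
def expo : GTy → Expo
  | base e => e
  | arr e _ _ => e

/-- `!^n Θ`, where `!^n !^e` is identified with `!^(n + e)`. -/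
def bang (n : ℕ) : GTy → GTy
  | base e => base (n :: e)
  | arr e Θ Δ => arr (n :: e) Θ Δ

/-- Replace the exponent of the outermost modality by the single variable `n`. -/
def setExpo (n : ℕ) : GTy → GTy
  | base _ => base [n]
  | arr _ Θ Δ => arr [n] Θ Δ

end GTy

/-- Linear constraints: `eqZero e f` is `∑ e - ∑ f = 0` and `geOne e` is `∑ e ≥ 1`. -/
inductive Constr : Type
  | eqZero (e f : Expo)
  | geOne (e : Expo)

/-- `A^j - c` for an equality constraint `A^j`; inequalities are never modified. -/
def Constr.sub (c : ℕ) : Constr → Constr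
  | .eqZero e f => .eqZero e (c :: f)
  | .geOne e => .geOne e

/-- A row of the constraint matrix, with a name by which slices refer to it. -/
structure Row where
  name : ℕ
  constr : Constr

/-- An element `x : Θ` of a base, together with the occurrence of `x` it stands for. -/
structure Entry where
  var : ℕ
  occ : ℕ
  ty : GTy

/-- A slice: a list of critical points (name of a constraint, list of free variable
occurrences). -/
abbrev Slice := List (ℕ × List ℕ)

/-- The variable occurrence `y` belongs to one of the lists of the slice. -/
def Slice.hasOcc (sl : Slice) (y : ℕ) : Bool := sl.any fun p => p.2.contains y

/-- The constraint named `j` belongs to the slice. -/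
def Slice.hasRow (sl : Slice) (j : ℕ) : Bool := sl.any fun p => p.1 == j

/-- The quadruple `⟨Θ, B, A, cpts⟩`. The base is a multiset with exactly one element for each
free variable occurrence of the term. -/
structure Result where
  ty : GTy
  base : List Entry
  rows : List Row
  cpts : List Slice

/-! ### The type synthesis algorithm -/

/-- Computations that may draw fresh names and that may fail. -/
abbrev Fresh := StateT ℕ Option

/-- A fresh name. -/
def fresh : Fresh ℕ := fun n => some (n, n + 1)

/-- Give fresh names to constraints. -/
def nameRows : List Constr → Fresh (List Row)
  | [] => pure []
  | c :: cs => do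
    let j ← fresh
    let rs ← nameRows cs
    pure (⟨j, c⟩ :: rs)

/-- Binary unification; undefined on types of different shapes. The first constraint is the
one between the outermost exponents. -/
def unify : GTy → GTy → Option (List Constr)
  | .base e, .base f => some [.eqZero e f]
  | .arr e Θ Δ, .arr f Θ' Δ' => do
    let A ← unify Θ Θ'
    let A' ← unify Δ Δ'
    some (.eqZero e f :: (A ++ A'))
  | _, _ => none

/-- Unification of a list of types: consecutive ones are made equal. -/
def unifyAll : List GTy → Option (List Constr)
  | Θ :: Θ' :: Θs => do
    let A ← unify Θ Θ'
    let A' ← unifyAll (Θ' :: Θs)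
    some (A ++ A')
  | _ => some []

/-- Contraction of a list of types. -/
def contract : List GTy → Option (List Constr)
  | Θ :: Θ' :: Θs => do
    let A ← unifyAll (Θ :: Θ' :: Θs)
    some (.geOne Θ.expo :: A)
  | _ => some []

/-- Type processing: a fresh exponent everywhere. -/
def process : STy → Fresh GTy
  | .o => do
    let p ← fresh
    pure (.base [p])
  | .arr σ τ => do
    let p ← fresh
    let Θ ← process σ
    let Δ ← process τ
    pure (.arr [p] Θ Δ)

/-- The inner boxing procedure: for each slice, `c` boxes that close at its critical points. -/
def boxSlices : List Slice → List Entry → GTy → List Row → Fresh (List Entry × GTy × List Row)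
  | [], B, Γ, A => pure (B, Γ, A)
  | sl :: cpts, B, Γ, A => do
    let c ← fresh
    boxSlices cpts
      (B.map fun e => if sl.hasOcc e.occ then e else { e with ty := e.ty.bang c })
      (Γ.bang c)
      (A.map fun r => if sl.hasRow r.name then { r with constr := r.constr.sub c } else r)

/-- The boxing function applied to the synthesis `r` of the term `M`: variables are not boxed;
any other term gets the boxes through its critical points and then `b` boxes around it. The
critical points are kept (they refer to the constraints by name). -/
def boxing (M : Lam) (r : Result) : Fresh Result :=
  if M.isVar then pure r
  else do
    let (B, Γ, A) ← boxSlices r.cpts r.base r.ty r.rows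
    let b ← fresh
    pure ⟨Γ.bang b, B.map fun e => { e with ty := e.ty.bang b }, A, r.cpts⟩

/-- Product union of sets of slices. -/
def prodUnion : List Slice → List Slice → List Slice
  | [], cpts => cpts
  | cpts, [] => cpts
  | sl :: cpts₁, cpts₂ => (sl :: cpts₂.map fun sl' => sl ++ sl') ++ prodUnion cpts₁ cpts₂

/-- The free variable occurrences of a term, read off from its base. -/
def fvo (B : List Entry) : List ℕ := B.map Entry.occ

/-- Variable case. -/
def synthVar (i : ℕ) (σ : STy) : Fresh Result := do
  let Θ ← process σ
  let y ← fresh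
  pure ⟨Θ, [⟨i, y, Θ⟩], [], []⟩

/-- Abstraction cases, for `λ x. M` with `x : σ`, given the synthesis `r` of `M`. The bound
variable is the index `0`; the first case is the one where it occurs in `M`. -/
def synthLam (σ : STy) (M : Lam) (r : Result) : Fresh Result := do
  let ⟨Γ, B', A, cpts⟩ ← boxing M r
  let Bx := B'.filter fun e => e.var == 0
  let B := (B'.filter fun e => e.var != 0).map fun e => { e with var := e.var - 1 }
  match Bx with
  | e :: es =>
    let A₃ ← contract ((e :: es).map Entry.ty)
    let R₃ ← nameRows A₃
    -- the slices in which the bound variable occurs are discarded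
    pure ⟨.arr [] e.ty Γ, B, A ++ R₃,
      cpts.filter fun sl => !((e :: es).any fun e' => sl.hasOcc e'.occ)⟩
  | [] =>
    let Θ ← process σ
    if M.isApp then
      let n ← fresh
      let j ← fresh
      pure ⟨.arr [] Θ (Γ.setExpo n), B, A ++ [⟨j, .eqZero Γ.expo [n]⟩],
        cpts ++ [[(j, fvo B)]]⟩
    else
      pure ⟨.arr [] Θ Γ, B, A, cpts⟩

/-- The four application cases, for `(M N)`, given the syntheses `r₁` of `M` and `r₂` of `N`.
There is a critical point at the root of `M` (resp. `N`) if `M` (resp. `N`) is itself an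
application. -/
def synthApp (M N : Lam) (r₁ r₂ : Result) : Fresh Result :=
  match r₁.ty with
  | .base _ => failure
  | .arr ns Θ₁ Γ => do
    let ⟨Θ₃, B₃, A₃, cpts₂⟩ ← boxing N r₂
    let A₄ ← if N.isApp then unify Θ₃ Θ₁ else unify Θ₁ Θ₃
    let R₄ ← nameRows A₄
    let j ← fresh
    let cptsM := if M.isApp then r₁.cpts ++ [[(j, fvo r₁.base)]] else r₁.cpts
    let cptsN := if N.isApp then
        cpts₂ ++ (R₄.take 1).map fun r => [(r.name, fvo B₃)]
      else cpts₂
    pure ⟨Γ, r₁.base ++ B₃, r₁.rows ++ A₃ ++ R₄ ++ [⟨j, .eqZero ns []⟩], prodUnion cptsM cptsN⟩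

/-- The type synthesis function, by recursion on the simple type derivation. -/
def synth : {Γ : List STy} → {M : Lam} → {σ : STy} → SDer Γ M σ → Fresh Result
  | _, _, _, .var (σ := σ) i _ => synthVar i σ
  | _, _, _, .lam (σ := σ) (M := M) d => do
    let r ← synth d
    synthLam σ M r
  | _, _, _, .app (M := M) (N := N) d e => do
    let r₁ ← synth d
    let r₂ ← synth e
    synthApp M N r₁ r₂

/-- Contraction of the common variables of a base: for each variable `x` of the list, keep the
first element `x : Θ` of the base and contract all of them. -/
def contractBase (B : List Entry) : List ℕ → Option (List (ℕ × GTy) × List Constr)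
  | [] => some ([], [])
  | x :: xs => do
    let Θs := (B.filter fun e => e.var == x).map Entry.ty
    let A ← contract Θs
    let (B', A') ← contractBase B xs
    some ((Θs.take 1).map (fun Θ => (x, Θ)) ++ B', A ++ A')

/-- The type synthesis algorithm: the triple `⟨Θ, B, A⟩` computed for a simply typed term. -/
def typeSynthesis {Γ : List STy} {M : Lam} {σ : STy} (d : SDer Γ M σ) :
    Option (GTy × List (ℕ × GTy) × List Constr) := do
  let (r, _) ← (synth d >>= boxing M).run 0
  let (B, A) ← contractBase r.base (r.base.map Entry.var).dedup
  some (r.ty, B, r.rows.map Row.constr ++ A)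

/-! ### EAL formulas, instantiations -/

/-- EAL formulas. -/
inductive Ty : Type
  | o
  | lolli (A B : Ty)
  | bang (A : Ty)

/-- The value of a formal sum. -/
def Expo.eval (X : ℕ → ℕ) (e : Expo) : ℕ := (e.map X).sum

/-- `X(Θ)`. -/
def GTy.inst (X : ℕ → ℕ) : GTy → Ty
  | .base e => Ty.bang^[Expo.eval X e] Ty.o
  | .arr e Θ Δ => Ty.bang^[Expo.eval X e] (Ty.lolli (Θ.inst X) (Δ.inst X))

def Constr.Sat (X : ℕ → ℕ) : Constr → Prop
  | .eqZero e f => (Expo.eval X e : ℤ) - (Expo.eval X f : ℤ) = 0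
  | .geOne e => 1 ≤ Expo.eval X e

/-- `X` is a solution of the set of constraints `A`; the variables range over the natural
numbers. -/
def IsSolution (X : ℕ → ℕ) (A : List Constr) : Prop := ∀ c ∈ A, c.Sat X

/-- Linear bases: each variable has at most one formula. -/
abbrev Ctx := ℕ → Option Ty

/-- `Γ, x : A` for the variable `x` of index `0`. -/
def Ctx.cons (A : Ty) (Γ : Ctx) : Ctx
  | 0 => some A
  | i + 1 => Γ i

/-- `Ξ` is the union of the bases `Δ i`, and these have pairwise disjoint domains. -/
def Ctx.IsUnion {ι : Type} (Ξ : Ctx) (Δ : ι → Ctx) : Prop :=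
  (∀ i j x, Δ i x ≠ none → Δ j x ≠ none → i = j) ∧
    ∀ x A, Ξ x = some A ↔ ∃ i, Δ i x = some A

/-- `X(B)`. -/
def instBase (X : ℕ → ℕ) (B : List (ℕ × GTy)) : Ctx := fun x => (B.lookup x).map (GTy.inst X)

/-! ### Elementary affine terms -/

/-- Elementary affine terms. `prom n M N` is `!(M)[N₀/x₀, …, N_{n-1}/x_{n-1}]`, where `x_i` is
the index `i` in `M`; `contr M N` is the contraction `[M]_{N/x,y}`, where `x` and `y` are the
indices `0` and `1` in `M`. -/
inductive EATerm : Type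
  | var (i : ℕ)
  | lam (M : EATerm)
  | app (M N : EATerm)
  | prom (n : ℕ) (M : EATerm) (N : Fin n → EATerm)
  | contr (M N : EATerm)

namespace EATerm

/-- Free variables. -/
def FV : EATerm → Set ℕ
  | var i => {i}
  | lam M => {i | i + 1 ∈ FV M}
  | app M N => FV M ∪ FV N
  | prom n M N => (⋃ k, FV (N k)) ∪ {i | i + n ∈ FV M}
  | contr M N => {i | i + 2 ∈ FV M} ∪ FV N

/-- The underlying lambda term `P*`. -/
def star : EATerm → Lam
  | var i => .var i
  | lam M => .lam (star M)
  | app M N => .app (star M) (star N)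
  | prom n M N =>
      (star M).subst fun i => if h : i < n then star (N ⟨i, h⟩) else .var (i - n)
  | contr M N => (star M).subst fun i => if i < 2 then star N else .var (i - 2)

/-- The length `L(P)`. -/
def length : EATerm → ℕ
  | var _ => 0
  | lam M => 1 + length M
  | app M N => 1 + length M + length N
  | prom _ M N => length M + ∑ k, length (N k)
  | contr M N => length M + length N

/-- Legal terms. -/
def Legal : EATerm → Prop
  | var _ => True
  | lam M => Legal M
  | app M N => Legal M ∧ Legal N ∧ Disjoint M.FV N.FV
  | prom n M N => Legal M ∧ (∀ k, Legal (N k)) ∧ M.FV = {i | i < n} ∧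
      ∀ k l, k ≠ l → Disjoint (N k).FV (N l).FV
  | contr M N => Legal M ∧ Legal N ∧ Disjoint {i | i + 2 ∈ M.FV} N.FV

/-- `Subterm Q P`: `Q` is a subterm of `P`. -/
inductive Subterm : EATerm → EATerm → Prop
  | refl (P : EATerm) : Subterm P P
  | lam {Q M : EATerm} : Subterm Q M → Subterm Q (lam M)
  | appL {Q M N : EATerm} : Subterm Q M → Subterm Q (app M N)
  | appR {Q M N : EATerm} : Subterm Q N → Subterm Q (app M N)
  | promBody {Q M : EATerm} {n : ℕ} {N : Fin n → EATerm} :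
      Subterm Q M → Subterm Q (prom n M N)
  | promArg {Q M : EATerm} {n : ℕ} {N : Fin n → EATerm} (k : Fin n) :
      Subterm Q (N k) → Subterm Q (prom n M N)
  | contrBody {Q M N : EATerm} : Subterm Q M → Subterm Q (contr M N)
  | contrArg {Q M N : EATerm} : Subterm Q N → Subterm Q (contr M N)

/-- The redexes (left-hand sides) of the reduction rules other than beta. -/
inductive Redex : EATerm → Prop
  | dup (N M : EATerm) (n : ℕ) (P : Fin n → EATerm) : Redex (contr N (prom n M P))
  | bangBang (n : ℕ) (M : EATerm) (N : Fin n → EATerm) (k : Fin n)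
      (m : ℕ) (R : EATerm) (P : Fin m → EATerm) (h : N k = prom m R P) : Redex (prom n M N)
  | appContrL (M M₁ N : EATerm) : Redex (app (contr M M₁) N)
  | appContrR (M N N₁ : EATerm) : Redex (app M (contr N N₁))
  | bangContr (n : ℕ) (M : EATerm) (N : Fin n → EATerm) (k : Fin n)
      (R Q : EATerm) (h : N k = contr R Q) : Redex (prom n M N)
  | contrContr (M N P : EATerm) : Redex (contr M (contr N P))
  | lamContr (M N : EATerm) (h : 0 ∉ N.FV) : Redex (lam (contr M N))

/-- No subterm is a redex of one of the reduction rules other than beta. -/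
def Normal (P : EATerm) : Prop := ∀ Q, Subterm Q P → ¬ Redex Q

/-- Simple terms. -/
def Simple (P : EATerm) : Prop :=
  (∀ M N, Subterm (contr M N) P → ∃ i, N.star = .var i) ∧ P.length = P.star.length

/-- Candidate EAL-terms (EAL-terms are legal). -/
structure Candidate (P : EATerm) : Prop where
  legal : P.Legal
  normal : P.Normal
  simple : P.Simple
  contr_mem : ∀ R Q, Subterm (contr R Q) P → 0 ∈ R.FV ∧ 1 ∈ R.FV
  prom_ne_var : ∀ n R Q, Subterm (prom n R Q) P → ∀ i, R ≠ var i

end EATerm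

/-! ### The term assignment system -/

/-- `NEAL Γ P A` is the judgement `Γ ⊢ P : A` of natural deduction for elementary affine
logic. -/
inductive NEAL : Ctx → EATerm → Ty → Prop
  | ax {Γ : Ctx} {i : ℕ} {A : Ty} (h : Γ i = some A) : NEAL Γ (.var i) A
  | contr {Ξ Γ Δ : Ctx} {M N : EATerm} {A B : Ty} (h : Ξ.IsUnion ![Γ, Δ])
      (hM : NEAL Γ M (.bang A))
      (hN : NEAL (Ctx.cons (.bang A) (Ctx.cons (.bang A) Δ)) N B) : NEAL Ξ (.contr N M) B
  | lam {Γ : Ctx} {M : EATerm} {A B : Ty} (h : NEAL (Ctx.cons A Γ) M B) :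
      NEAL Γ (.lam M) (.lolli A B)
  | app {Ξ Γ Δ : Ctx} {M N : EATerm} {A B : Ty} (h : Ξ.IsUnion ![Γ, Δ])
      (hM : NEAL Γ M (.lolli A B)) (hN : NEAL Δ N A) : NEAL Ξ (.app M N) B
  | prom {Ξ Γ : Ctx} {n : ℕ} {Δ : Fin n → Ctx} {N : EATerm} {M : Fin n → EATerm}
      {A : Fin n → Ty} {B : Ty} (h : Ξ.IsUnion (fun k : Option (Fin n) => k.elim Γ Δ))
      (hM : ∀ k, NEAL (Δ k) (M k) (.bang (A k)))
      (hN : NEAL (fun i => if h : i < n then some (A ⟨i, h⟩) else none) N B) :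
      NEAL Ξ (.prom n N M) (.bang B)

end EAL

/-! The proof separates where boxes are from how they are written. An intermediate object is a
skeleton: the syntax tree of `M` with a distinct name for every variable occurrence, each node
carrying its level, the number of boxes around it. In `LTyped`, a child may have a higher level than
its parent (boxes open around it) or a lower one (boxes close at it), and the types change by the
corresponding number of modalities. Every node requires its free occurrences to be declared at
levels at most its own; this is what makes closing a box legitimate. Variables never have boxes
opened around them, and an abstraction binding several occurrences has a modal argument type.

From skeletons to terms: the outermost box of a skeleton at level `a + 1` is found by `LTyped.cut`.
The subterms at which that box closes, together with the occurrences declared outside it, become the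
box arguments, typed at level 0. The rest is the body, typed at level `a`. The body is not a
variable, so every argument is strictly shorter, and `LTyped.exists_realizes` concludes by induction
on length and level. Contractions are inserted by `exists_realizes_of_injOn` only directly under a
binder, at the top, or inside one another's bodies, and always contract a variable. Box arguments
have level 0 and so are not boxes. Hence no redex other than beta arises.

From the algorithm to skeletons: the result for a subterm must remain correct under later boxings,
which subtract fresh variables from the rows of slices. The invariant `SynthTyped` therefore
quantifies over all lists `w` of slices with weights. A weight counts boxes placed around the term
and closed at the critical points of the slice. A row has to hold after subtraction of the weight of
the slices containing it; an occurrence in a slice lies outside the boxes of that slice and gets no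
modality from them. `boxing_spec` turns the values of the fresh variables into weights. At an
application, `exists_wt_prodUnion` projects weights on a product union to the two sides; the sides
do not interfere because their names lie in disjoint intervals. The weight of a critical point at
the root of a subterm, isolated by `exists_wt_snoc`, is the number of boxes closing there.
`synth_spec` assembles the cases; with no weights and level 0 it gives the skeleton to realize. -/

namespace EAL

/-! ### Substitution in pure lambda terms -/

namespace Lam

/-- Extension of a renaming under a binder. -/
def upr (ρ : ℕ → ℕ) : ℕ → ℕ := fun i => Nat.casesOn i 0 (fun j => ρ j + 1)

/-- Extension of a substitution under a binder. -/
def ups (s : ℕ → Lam) : ℕ → Lam :=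
  fun i => Nat.casesOn i (var 0) (fun j => rename Nat.succ (s j))

theorem rename_lam (ρ : ℕ → ℕ) (M : Lam) : rename ρ (lam M) = lam (rename (upr ρ) M) := rfl

theorem subst_lam (s : ℕ → Lam) (M : Lam) : subst s (lam M) = lam (subst (ups s) M) := rfl

theorem rename_rename (M : Lam) (ρ ρ' : ℕ → ℕ) :
    (M.rename ρ).rename ρ' = M.rename (ρ' ∘ ρ) := by
  induction M generalizing ρ ρ' with
  | var i => rfl
  | lam M ih =>
    simp only [rename_lam, ih]
    congr 2
    funext i
    cases i <;> rfl
  | app M N ihM ihN => simp only [rename, ihM, ihN]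

theorem subst_rename (M : Lam) (ρ : ℕ → ℕ) (s : ℕ → Lam) :
    (M.rename ρ).subst s = M.subst (s ∘ ρ) := by
  induction M generalizing ρ s with
  | var i => rfl
  | lam M ih =>
    simp only [rename_lam, subst_lam, ih]
    congr 2
    funext i
    cases i <;> rfl
  | app M N ihM ihN => simp only [rename, subst, ihM, ihN]

theorem rename_subst (M : Lam) (ρ : ℕ → ℕ) (s : ℕ → Lam) :
    (M.subst s).rename ρ = M.subst (fun i => (s i).rename ρ) := by
  induction M generalizing ρ s with
  | var i => rfl
  | lam M ih =>
    simp only [rename_lam, subst_lam, ih]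
    congr 2
    funext i
    cases i with
    | zero => rfl
    | succ i =>
      change ((s i).rename Nat.succ).rename (upr ρ) = ((s i).rename ρ).rename Nat.succ
      rw [rename_rename, rename_rename]
      rfl
  | app M N ihM ihN => simp only [rename, subst, ihM, ihN]

theorem subst_ups_rename_succ (M : Lam) (s : ℕ → Lam) :
    (M.rename Nat.succ).subst (ups s) = (M.subst s).rename Nat.succ := by
  rw [subst_rename, rename_subst]
  rfl

theorem length_rename (M : Lam) (ρ : ℕ → ℕ) : (M.rename ρ).length = M.length := by
  induction M generalizing ρ with
  | var i => rfl
  | lam M ih => simp only [rename_lam, length, ih]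
  | app M N ihM ihN => simp only [rename, length, ihM, ihN]

end Lam

/-! ### Skeletons: lambda terms whose variable occurrences have names -/

/-- Lambda terms in which every variable occurrence has a name of its own; an abstraction binds
a set of occurrences. -/
inductive Skel : Type
  | leaf (y : ℕ)
  | lam (S : Finset ℕ) (D : Skel)
  | app (D E : Skel)

namespace Skel

/-- The names of the free occurrences. -/
def fv : Skel → Finset ℕ
  | leaf y => {y}
  | lam S D => D.fv \ S
  | app D E => D.fv ∪ E.fv

/-- The names of all occurrences. -/
def leaves : Skel → Finset ℕ
  | leaf y => {y}
  | lam _ D => D.leaves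
  | app D E => D.leaves ∪ E.leaves

/-- The name of the leftmost occurrence. -/
def name : Skel → ℕ
  | leaf y => y
  | lam _ D => D.name
  | app D _ => D.name

/-- Different occurrences have different names, and abstractions bind free occurrences. -/
def Lin : Skel → Prop
  | leaf _ => True
  | lam S D => S ⊆ D.fv ∧ D.Lin
  | app D E => Disjoint D.leaves E.leaves ∧ D.Lin ∧ E.Lin

/-- The number of abstractions and applications. -/
def len : Skel → ℕ
  | leaf _ => 0
  | lam _ D => 1 + D.len
  | app D E => 1 + D.len + E.len

/-- Extension of an environment under an abstraction that binds `S`. -/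
def lift (S : Finset ℕ) (s : ℕ → Lam) : ℕ → Lam :=
  fun y => if y ∈ S then .var 0 else (s y).rename Nat.succ

/-- The lambda term obtained by replacing the free occurrence `y` by `s y`. -/
def er : (ℕ → Lam) → Skel → Lam
  | s, leaf y => s y
  | s, lam S D => .lam (er (lift S s) D)
  | s, app D E => .app (er s D) (er s E)

theorem fv_subset_leaves (D : Skel) : D.fv ⊆ D.leaves := by
  induction D with
  | leaf y => exact subset_rfl
  | lam S D ih => exact Finset.sdiff_subset.trans ih
  | app D E ihD ihE => exact Finset.union_subset_union ihD ihE

theorem name_mem_leaves (D : Skel) : D.name ∈ D.leaves := by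
  induction D with
  | leaf y => exact Finset.mem_singleton_self y
  | lam S D ih => exact ih
  | app D E ihD ihE => exact Finset.mem_union_left _ ihD

theorem er_congr (D : Skel) {s t : ℕ → Lam} (h : ∀ y ∈ D.fv, s y = t y) :
    er s D = er t D := by
  induction D generalizing s t with
  | leaf y => exact h y (Finset.mem_singleton_self y)
  | lam S D ih =>
    simp only [er]
    congr 1
    refine ih fun y hy => ?_
    unfold lift
    split_ifs with hS
    · rfl
    · rw [h y (Finset.mem_sdiff.2 ⟨hy, hS⟩)]
  | app D E ihD ihE =>
    simp only [er]
    rw [ihD fun y hy => h y (Finset.mem_union_left _ hy),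
      ihE fun y hy => h y (Finset.mem_union_right _ hy)]

theorem er_subst (D : Skel) (s t : ℕ → Lam) :
    (er s D).subst t = er (fun y => (s y).subst t) D := by
  induction D generalizing s t with
  | leaf y => rfl
  | lam S D ih =>
    simp only [er, Lam.subst_lam, ih]
    congr 2
    funext y
    unfold lift
    split_ifs
    · rfl
    · exact Lam.subst_ups_rename_succ _ _
  | app D E ihD ihE => simp only [er, Lam.subst, ihD, ihE]

theorem er_rename (D : Skel) (s : ℕ → Lam) (ρ : ℕ → ℕ) :
    (er s D).rename ρ = er (fun y => (s y).rename ρ) D := by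
  induction D generalizing s ρ with
  | leaf y => rfl
  | lam S D ih =>
    simp only [er, Lam.rename_lam, ih]
    congr 2
    funext y
    unfold lift
    split_ifs
    · rfl
    · rw [Lam.rename_rename, Lam.rename_rename]
      rfl
  | app D E ihD ihE => simp only [er, Lam.rename, ihD, ihE]

theorem length_er (D : Skel) (s : ℕ → Lam) (hs : ∀ y, (s y).length = 0) :
    (er s D).length = D.len := by
  induction D generalizing s with
  | leaf y => exact hs y
  | lam S D ih =>
    simp only [er, Lam.length, len]
    rw [ih]
    intro y
    unfold lift
    split_ifs
    · rfl
    · rw [Lam.length_rename, hs]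
  | app D E ihD ihE => simp only [er, Lam.length, len, ihD s hs, ihE s hs]

end Skel

/-! ### Iterated modalities -/

theorem bang_iterate_eq_lolli {n : ℕ} {A B C : Ty} (h : Ty.bang^[n] A = .lolli B C) : n = 0 := by
  cases n with
  | zero => rfl
  | succ n => rw [Function.iterate_succ_apply'] at h; cases h

/-! ### Levelled typing of skeletons -/

/-- Environment of an abstraction body: the occurrences in `S` are declared at level `a`. -/
def extEnv (Γ : ℕ → ℕ × Ty) (S : Finset ℕ) (a : ℕ) (A : Ty) : ℕ → ℕ × Ty :=
  fun y => if y ∈ S then (a, A) else Γ y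

/-- `LTyped a Γ D A`: inside `a` nested boxes the skeleton `D` has type `A`, where `Γ y` is the
number of boxes around the place where `y` is declared together with its type there. Passing
from a term to an immediate subterm may open boxes or close boxes, but a box can be
closed only at a subterm all of whose free occurrences are declared outside of that box. -/
inductive LTyped : ℕ → (ℕ → ℕ × Ty) → Skel → Ty → Prop
  | leaf {a : ℕ} {Γ : ℕ → ℕ × Ty} {y : ℕ} {A : Ty} (hl : (Γ y).1 ≤ a)
      (h : (Γ y).2 = Ty.bang^[a - (Γ y).1] A) : LTyped a Γ (.leaf y) A
  | lam {a a' : ℕ} {Γ : ℕ → ℕ × Ty} {S : Finset ℕ} {D : Skel} {A B B' : Ty}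
      (hl : ∀ y ∈ (Skel.lam S D).fv, (Γ y).1 ≤ a)
      (hD : LTyped a' (extEnv Γ S a A) D B') (hB : Ty.bang^[a'] B' = Ty.bang^[a] B)
      (hv : ∀ y, D = .leaf y → a' ≤ a) (hc : 2 ≤ S.card → ∃ A', A = .bang A') :
      LTyped a Γ (.lam S D) (.lolli A B)
  | app {a a₁ a₂ : ℕ} {Γ : ℕ → ℕ × Ty} {D E : Skel} {A' A B' B : Ty}
      (hl : ∀ y ∈ (Skel.app D E).fv, (Γ y).1 ≤ a)
      (hD : LTyped a₁ Γ D A') (hA : Ty.bang^[a₁] A' = Ty.bang^[a] (.lolli B A))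
      (hE : LTyped a₂ Γ E B') (hB : Ty.bang^[a₂] B' = Ty.bang^[a] B)
      (hvD : ∀ y, D = .leaf y → a₁ ≤ a) (hvE : ∀ y, E = .leaf y → a₂ ≤ a) :
      LTyped a Γ (.app D E) A

namespace LTyped

/-- Applied to a child of lower level than its parent, this is the side condition for closing boxes:
no free occurrence of the child is declared inside a box being closed. -/
theorem level_le {a : ℕ} {Γ : ℕ → ℕ × Ty} {D : Skel} {A : Ty} (h : LTyped a Γ D A) :
    ∀ y ∈ D.fv, (Γ y).1 ≤ a := by
  cases h with
  | leaf hl h => intro y hy; rw [Finset.mem_singleton.1 hy]; exact hl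
  | lam hl => exact hl
  | app hl => exact hl

theorem congr {a : ℕ} {Γ Γ' : ℕ → ℕ × Ty} {D : Skel} {A : Ty} (h : LTyped a Γ D A)
    (hΓ : ∀ y ∈ D.fv, Γ y = Γ' y) : LTyped a Γ' D A := by
  induction h generalizing Γ' with
  | @leaf a Γ y A hl h =>
    have e := hΓ y (Finset.mem_singleton_self y)
    exact .leaf (e ▸ hl) (e ▸ h)
  | @lam a a' Γ S D A B B' hl hD hB hv hc ih =>
    refine .lam (fun y hy => hΓ y hy ▸ hl y hy) (ih fun y hy => ?_) hB hv hc
    unfold extEnv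
    split_ifs with hS
    · rfl
    · exact hΓ y (Finset.mem_sdiff.2 ⟨hy, hS⟩)
  | @app a a₁ a₂ Γ D E A' A B' B hl hD hA hE hB hvD hvE ihD ihE =>
    exact .app (fun y hy => hΓ y hy ▸ hl y hy)
      (ihD fun y hy => hΓ y (Finset.mem_union_left _ hy)) hA
      (ihE fun y hy => hΓ y (Finset.mem_union_right _ hy)) hB hvD hvE

end LTyped

/-! ### Cutting a skeleton along the outermost box -/

/-- `D'` is what remains of `D` inside the outermost box: the subterms at which that box is
closed are the first components of `Ds`, and each of them is replaced by a leaf. -/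
structure IsCut (Γ : ℕ → ℕ × Ty) (D D' : Skel) (Ds : List (Skel × Ty)) : Prop where
  leaves_subset : D'.leaves ⊆ D.leaves
  mem_fv : ∀ y, y ∈ D'.fv ↔ (y ∈ D.fv ∧ 1 ≤ (Γ y).1) ∨ ∃ p ∈ Ds, p.1.name = y
  lin : D'.Lin
  len_eq : D.len = D'.len + (Ds.map fun p => p.1.len).sum
  piece_leaves : ∀ p ∈ Ds, p.1.leaves ⊆ D.leaves
  piece_fv : ∀ p ∈ Ds, ∀ y ∈ p.1.fv, y ∈ D.fv ∧ (Γ y).1 = 0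
  piece_lin : ∀ p ∈ Ds, p.1.Lin
  piece_typed : ∀ p ∈ Ds, LTyped 0 Γ p.1 (.bang p.2)
  piece_name : ∀ p ∈ Ds, ∀ y ∈ D.fv, 1 ≤ (Γ y).1 → p.1.name ≠ y
  pairwise : Ds.Pairwise fun p q => Disjoint p.1.leaves q.1.leaves
  cover : ∀ y ∈ D.fv, (Γ y).1 = 0 → ∃ p ∈ Ds, y ∈ p.1.fv
  er_eq : ∀ s s' : ℕ → Lam, (∀ y ∈ D.fv, 1 ≤ (Γ y).1 → s' y = s y) →
    (∀ p ∈ Ds, s' p.1.name = Skel.er s p.1) → Skel.er s' D' = Skel.er s D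

/-- The environment inside the outermost box. -/
def CutEnv (Γ Γ' : ℕ → ℕ × Ty) (D : Skel) (Ds : List (Skel × Ty)) : Prop :=
  (∀ y ∈ D.fv, 1 ≤ (Γ y).1 → Γ' y = ((Γ y).1 - 1, (Γ y).2)) ∧
    ∀ p ∈ Ds, Γ' p.1.name = (0, p.2)

namespace IsCut

/-- The box closes at the root: everything is a single piece, and only the leaf standing for it
remains inside. -/
theorem whole {Γ : ℕ → ℕ × Ty} {D : Skel} {A : Ty} (hl : D.Lin)
    (hD : LTyped 0 Γ D (.bang A)) : IsCut Γ D (.leaf D.name) [(D, A)] := by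
  have hlev : ∀ y ∈ D.fv, (Γ y).1 = 0 := fun y hy => Nat.le_zero.1 (hD.level_le y hy)
  constructor
  · intro y hy
    rw [Finset.mem_singleton.1 hy]
    exact D.name_mem_leaves
  · intro y
    simp only [Skel.fv, Finset.mem_singleton, List.mem_singleton, exists_eq_left]
    constructor
    · intro h; exact .inr h.symm
    · rintro (⟨h, h'⟩ | h)
      · have := hlev y h; omega
      · exact h.symm
  · trivial
  · simp [Skel.len]
  · simp
  · simpa using fun y hy => And.intro hy (hlev y hy)
  · simpa using hl
  · simpa using hD
  · intro p hp y hy h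
    have := hlev y hy
    omega
  · simp
  · intro y hy _
    exact ⟨_, List.mem_singleton_self _, hy⟩
  · intro s s' _ h
    exact h _ (List.mem_singleton_self _)

theorem leaf_inner {Γ : ℕ → ℕ × Ty} {y : ℕ} (h : 1 ≤ (Γ y).1) :
    IsCut Γ (.leaf y) (.leaf y) [] := by
  constructor <;> simp [Skel.fv, Skel.Lin, Skel.er]
  · exact h
  · omega
  · exact fun s s' h' => h' h

/-- Disjointness of all leaves, not just of the free ones, is needed: a piece is named after its
leftmost leaf, which may be bound inside the piece. -/
theorem app {Γ : ℕ → ℕ × Ty} {D D' E E' : Skel} {Ds Es : List (Skel × Ty)}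
    (hd : Disjoint D.leaves E.leaves) (hD : IsCut Γ D D' Ds) (hE : IsCut Γ E E' Es) :
    IsCut Γ (.app D E) (.app D' E') (Ds ++ Es) := by
  constructor
  · exact Finset.union_subset_union hD.leaves_subset hE.leaves_subset
  · intro y
    simp only [Skel.fv, Finset.mem_union, hD.mem_fv, hE.mem_fv, List.mem_append]
    constructor
    · rintro ((⟨h, h'⟩ | ⟨p, h, h'⟩) | (⟨h, h'⟩ | ⟨p, h, h'⟩))
      · exact .inl ⟨.inl h, h'⟩
      · exact .inr ⟨p, .inl h, h'⟩
      · exact .inl ⟨.inr h, h'⟩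
      · exact .inr ⟨p, .inr h, h'⟩
    · rintro (⟨h | h, h'⟩ | ⟨p, h | h, h'⟩)
      · exact .inl (.inl ⟨h, h'⟩)
      · exact .inr (.inl ⟨h, h'⟩)
      · exact .inl (.inr ⟨p, h, h'⟩)
      · exact .inr (.inr ⟨p, h, h'⟩)
  · exact ⟨hd.mono hD.leaves_subset hE.leaves_subset, hD.lin, hE.lin⟩
  · simp only [Skel.len, hD.len_eq, hE.len_eq, List.map_append, List.sum_append]
    omega
  · intro p hp
    rcases List.mem_append.1 hp with hp | hp
    · exact (hD.piece_leaves p hp).trans Finset.subset_union_left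
    · exact (hE.piece_leaves p hp).trans Finset.subset_union_right
  · intro p hp y hy
    rcases List.mem_append.1 hp with hp | hp
    · exact ⟨Finset.mem_union_left _ (hD.piece_fv p hp y hy).1, (hD.piece_fv p hp y hy).2⟩
    · exact ⟨Finset.mem_union_right _ (hE.piece_fv p hp y hy).1, (hE.piece_fv p hp y hy).2⟩
  · intro p hp
    exact (List.mem_append.1 hp).elim (hD.piece_lin p) (hE.piece_lin p)
  · intro p hp
    exact (List.mem_append.1 hp).elim (hD.piece_typed p) (hE.piece_typed p)
  · intro p hp y hy h
    rcases List.mem_append.1 hp with hp | hp <;> rcases Finset.mem_union.1 hy with hy | hy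
    · exact hD.piece_name p hp y hy h
    · exact Finset.disjoint_iff_ne.1 hd _ (hD.piece_leaves p hp p.1.name_mem_leaves) _
        (E.fv_subset_leaves hy)
    · exact (Finset.disjoint_iff_ne.1 hd _ (D.fv_subset_leaves hy) _
        (hE.piece_leaves p hp p.1.name_mem_leaves)).symm
    · exact hE.piece_name p hp y hy h
  · exact List.pairwise_append.2 ⟨hD.pairwise, hE.pairwise, fun p hp q hq =>
      hd.mono (hD.piece_leaves p hp) (hE.piece_leaves q hq)⟩
  · intro y hy h
    rcases Finset.mem_union.1 hy with hy | hy
    · obtain ⟨p, hp, hp'⟩ := hD.cover y hy h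
      exact ⟨p, List.mem_append_left _ hp, hp'⟩
    · obtain ⟨p, hp, hp'⟩ := hE.cover y hy h
      exact ⟨p, List.mem_append_right _ hp, hp'⟩
  · intro s s' h h'
    simp only [Skel.er]
    rw [hD.er_eq s s' (fun y hy => h y (Finset.mem_union_left _ hy))
        fun p hp => h' p (List.mem_append_left _ hp),
      hE.er_eq s s' (fun y hy => h y (Finset.mem_union_right _ hy))
        fun p hp => h' p (List.mem_append_right _ hp)]

/-- The bound occurrences are declared at level `a + 1`, hence inside the box. So no piece has one
of them free or is named after one, and the binder captures none of the leaves that replace pieces.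
-/
theorem lam {Γ : ℕ → ℕ × Ty} {S : Finset ℕ} {D D' : Skel} {Ds : List (Skel × Ty)} {a : ℕ}
    {A : Ty} (hS : S ⊆ D.fv) (hD : IsCut (extEnv Γ S (a + 1) A) D D' Ds) :
    IsCut Γ (.lam S D) (.lam S D') Ds := by
  have inS : ∀ y ∈ S, 1 ≤ (extEnv Γ S (a + 1) A y).1 := fun y hy => by simp [extEnv, hy]
  have outS : ∀ y, y ∉ S → extEnv Γ S (a + 1) A y = Γ y := fun y hy => by simp [extEnv, hy]
  have nameS : ∀ p ∈ Ds, p.1.name ∉ S := fun p hp h =>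
    hD.piece_name p hp _ (hS h) (inS _ h) rfl
  have fvS : ∀ p ∈ Ds, ∀ y ∈ p.1.fv, y ∉ S := fun p hp y hy h => by
    have := (hD.piece_fv p hp y hy).2
    have := inS y h
    omega
  constructor
  · exact hD.leaves_subset
  · intro y
    simp only [Skel.fv, Finset.mem_sdiff, hD.mem_fv]
    constructor
    · rintro ⟨⟨h, h'⟩ | h, hy⟩
      · exact .inl ⟨⟨h, hy⟩, outS y hy ▸ h'⟩
      · exact .inr h
    · rintro (⟨⟨h, hy⟩, h'⟩ | ⟨p, hp, rfl⟩)
      · exact ⟨.inl ⟨h, (outS y hy).symm ▸ h'⟩, hy⟩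
      · exact ⟨.inr ⟨p, hp, rfl⟩, nameS p hp⟩
  · exact ⟨fun y hy => (hD.mem_fv y).2 (.inl ⟨hS hy, inS y hy⟩), hD.lin⟩
  · simp only [Skel.len, hD.len_eq]
    omega
  · exact hD.piece_leaves
  · intro p hp y hy
    have hyS := fvS p hp y hy
    have := hD.piece_fv p hp y hy
    rw [outS y hyS] at this
    exact ⟨Finset.mem_sdiff.2 ⟨this.1, hyS⟩, this.2⟩
  · exact hD.piece_lin
  · intro p hp
    exact (hD.piece_typed p hp).congr fun y hy => outS y (fvS p hp y hy)
  · intro p hp y hy h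
    obtain ⟨hy, hyS⟩ := Finset.mem_sdiff.1 hy
    exact hD.piece_name p hp y hy ((outS y hyS).symm ▸ h)
  · exact hD.pairwise
  · intro y hy h
    obtain ⟨hy, hyS⟩ := Finset.mem_sdiff.1 hy
    exact hD.cover y hy ((outS y hyS).symm ▸ h)
  · intro s s' h h'
    simp only [Skel.er]
    congr 1
    refine hD.er_eq _ _ (fun y hy hl => ?_) fun p hp => ?_
    · unfold Skel.lift
      split_ifs with hyS
      · rfl
      · rw [h y (Finset.mem_sdiff.2 ⟨hy, hyS⟩) (outS y hyS ▸ hl)]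
    · rw [Skel.lift, if_neg (nameS p hp), h' p hp, Skel.er_rename]
      refine Skel.er_congr _ fun y hy => ?_
      rw [Skel.lift, if_neg (fvS p hp y hy)]

end IsCut

/-- Cutting an immediate subterm, given how a subterm inside the box is cut. -/
theorem LTyped.cut_child {a b : ℕ} {Γ : ℕ → ℕ × Ty} {D : Skel} {B B' : Ty} (hl : D.Lin)
    (hD : LTyped b Γ D B') (hB : Ty.bang^[b] B' = Ty.bang^[a + 1] B)
    (hv : ∀ y, D = .leaf y → b ≤ a + 1)
    (ih : ∀ b', b = b' + 1 → ∃ D' Ds, IsCut Γ D D' Ds ∧ (D'.len = 0 → D.len = 0) ∧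
      ∀ Γ', CutEnv Γ Γ' D Ds → LTyped b' Γ' D' B') :
    ∃ D' Ds, IsCut Γ D D' Ds ∧ ∀ Γ', CutEnv Γ Γ' D Ds →
      ∃ b' B'', LTyped b' Γ' D' B'' ∧ Ty.bang^[b'] B'' = Ty.bang^[a] B ∧
        ∀ y, D' = .leaf y → b' ≤ a := by
  cases b with
  | zero =>
    rw [Function.iterate_succ_apply'] at hB
    simp only [Function.iterate_zero, id_eq] at hB
    subst hB
    -- At level 0 the box closes at this very child, whose type is `!(!^a B)`. The leaf left inside
    -- is declared at level 0 with type `!^a B`, so at level `a` it has type `B`.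
    refine ⟨_, _, IsCut.whole hl hD, fun Γ' hΓ' => ⟨a, B, ?_, rfl, fun _ _ => le_rfl⟩⟩
    have := hΓ'.2 _ (List.mem_singleton_self _)
    exact .leaf (by rw [this]; exact Nat.zero_le _) (by rw [this]; rfl)
  | succ b =>
    obtain ⟨D', Ds, hc, h0, ht⟩ := ih b rfl
    refine ⟨D', Ds, hc, fun Γ' hΓ' => ⟨b, B', ht Γ' hΓ', ?_, ?_⟩⟩
    · rw [Function.iterate_succ_apply', Function.iterate_succ_apply'] at hB
      injection hB
    -- By `h0` the remainder is a leaf only if `D` already was one, and then `hv` bounds its level.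
    · rintro y rfl
      cases D with
      | leaf z => have := hv z rfl; omega
      | lam S D => simp [Skel.len] at h0
      | app D E => simp [Skel.len] at h0

/-- Nodes of positive level stay inside and lose one level, except occurrences declared at level 0,
which are pieces together with the subterms reached at level 0. Because the root constructor is
kept, a nonvariable leaves a nonvariable body, as condition (4) on candidates demands. -/
theorem LTyped.cut {c : ℕ} {Γ : ℕ → ℕ × Ty} {D : Skel} {A : Ty} (h : LTyped c Γ D A) (a : ℕ)
    (hc : c = a + 1) (hl : D.Lin) :
    ∃ D' Ds, IsCut Γ D D' Ds ∧ (D'.len = 0 → D.len = 0) ∧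
      ∀ Γ', CutEnv Γ Γ' D Ds → LTyped a Γ' D' A := by
  induction h generalizing a with
  | @leaf c Γ y A hy h =>
    subst hc
    -- An occurrence declared outside the outermost box enters it as an argument of the box; one
    -- declared inside stays, with the level of its declaration lowered by one.
    by_cases h0 : (Γ y).1 = 0
    · have hw : IsCut Γ (.leaf y) (.leaf y) [(.leaf y, Ty.bang^[a] A)] := by
        refine IsCut.whole (D := .leaf y) trivial (.leaf h0.le ?_)
        rw [h, h0, Nat.sub_zero, Function.iterate_succ_apply']
        rfl
      refine ⟨_, _, hw, fun _ => rfl, fun Γ' hΓ' => ?_⟩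
      have := hΓ'.2 _ (List.mem_singleton_self _)
      simp only [Skel.name] at this
      exact .leaf (by rw [this]; exact Nat.zero_le _) (by rw [this]; rfl)
    · refine ⟨_, _, IsCut.leaf_inner (by omega), fun _ => rfl, fun Γ' hΓ' => ?_⟩
      have := hΓ'.1 y (Finset.mem_singleton_self y) (by omega)
      refine .leaf (by rw [this]; simp only; omega) ?_
      rw [this]
      simp only [h]
      congr 1
      omega
  | @lam c b Γ S D A B B' hlev hD hB hv hS ih =>
    subst hc
    obtain ⟨D', Ds, hcut, ht⟩ :=
      hD.cut_child hl.2 hB hv fun b' hb' => ih b' hb' hl.2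
    refine ⟨_, _, hcut.lam hl.1, fun h => ?_, fun Γ' hΓ' => ?_⟩
    · simp [Skel.len] at h
    · have hΓ'' : CutEnv (extEnv Γ S (a + 1) A) (extEnv Γ' S a A) D Ds := by
        constructor
        · intro y hy h
          by_cases hyS : y ∈ S
          · simp [extEnv, hyS]
          · simp only [extEnv, hyS, if_false] at h ⊢
            exact hΓ'.1 y (Finset.mem_sdiff.2 ⟨hy, hyS⟩) h
        · intro p hp
          have : p.1.name ∉ S := fun h =>
            hcut.piece_name p hp _ (hl.1 h) (by simp [extEnv, h]) rfl
          simp only [extEnv, this, if_false]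
          exact hΓ'.2 p hp
      obtain ⟨b', B'', ht, hB'', hv''⟩ := ht _ hΓ''
      refine .lam (fun y hy => ?_) ht hB'' hv'' hS
      rcases ((hcut.lam hl.1).mem_fv y).1 hy with ⟨hy, hy'⟩ | ⟨p, hp, rfl⟩
      · rw [hΓ'.1 y hy hy']
        have := hlev y hy
        simp only
        omega
      · rw [hΓ'.2 p hp]
        exact Nat.zero_le _
  | @app c a₁ a₂ Γ D E A' A B' B hlev hD hA hE hB hvD hvE ihD ihE =>
    subst hc
    obtain ⟨D', Ds, hcD, htD⟩ := hD.cut_child hl.2.1 hA hvD fun b' hb' => ihD b' hb' hl.2.1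
    obtain ⟨E', Es, hcE, htE⟩ := hE.cut_child hl.2.2 hB hvE fun b' hb' => ihE b' hb' hl.2.2
    have hcut := hcD.app hl.1 hcE
    refine ⟨_, _, hcut, fun h => ?_, fun Γ' hΓ' => ?_⟩
    · simp [Skel.len] at h
    · obtain ⟨b₁, A'', htD, hA'', hvD'⟩ := htD Γ' ⟨fun y hy => hΓ'.1 y
        (Finset.mem_union_left _ hy), fun p hp => hΓ'.2 p (List.mem_append_left _ hp)⟩
      obtain ⟨b₂, B'', htE, hB'', hvE'⟩ := htE Γ' ⟨fun y hy => hΓ'.1 y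
        (Finset.mem_union_right _ hy), fun p hp => hΓ'.2 p (List.mem_append_right _ hp)⟩
      refine .app (fun y hy => ?_) htD hA'' htE hB'' hvD' hvE'
      rcases (hcut.mem_fv y).1 hy with ⟨hy, hy'⟩ | ⟨p, hp, rfl⟩
      · rw [hΓ'.1 y hy hy']
        have := hlev y hy
        simp only
        omega
      · rw [hΓ'.2 p hp]
        exact Nat.zero_le _

/-! ### Splitting bases -/

open Classical in
/-- The part of a base that concerns the variables in `s`. -/
noncomputable def Ctx.restrict (Ξ : Ctx) (s : Set ℕ) : Ctx := fun x => if x ∈ s then Ξ x else none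

theorem Ctx.restrict_of_mem {Ξ : Ctx} {s : Set ℕ} {x : ℕ} (h : x ∈ s) : Ξ.restrict s x = Ξ x :=
  if_pos h

theorem Ctx.mem_of_restrict_ne_none {Ξ : Ctx} {s : Set ℕ} {x : ℕ}
    (h : Ξ.restrict s x ≠ none) : x ∈ s := by
  by_contra hx
  exact h (if_neg hx)

theorem Ctx.isUnion_restrict {ι : Type} (Ξ : Ctx) (s : ι → Set ℕ)
    (hd : ∀ i j x, x ∈ s i → x ∈ s j → i = j) (hc : ∀ x, ∃ i, x ∈ s i) :
    Ξ.IsUnion fun i => Ξ.restrict (s i) := by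
  refine ⟨fun i j x hi hj =>
    hd i j x (mem_of_restrict_ne_none hi) (mem_of_restrict_ne_none hj), fun x A => ⟨?_, ?_⟩⟩
  · intro h
    obtain ⟨i, hi⟩ := hc x
    exact ⟨i, (restrict_of_mem hi).trans h⟩
  · rintro ⟨i, hi⟩
    dsimp only at hi
    rwa [restrict_of_mem (mem_of_restrict_ne_none (hi ▸ Option.some_ne_none A))] at hi

theorem Ctx.isUnion_restrict_compl (Ξ : Ctx) (s : Set ℕ) :
    Ξ.IsUnion ![Ξ.restrict s, Ξ.restrict sᶜ] := by
  have h := Ξ.isUnion_restrict ![s, sᶜ] ?_ ?_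
  · convert h using 1
    funext i
    fin_cases i <;> rfl
  · intro i j x hi hj
    fin_cases i <;> fin_cases j <;> simp_all
  · intro x
    by_cases hx : x ∈ s
    · exact ⟨0, hx⟩
    · exact ⟨1, hx⟩

/-! ### Realizing skeletons by elementary terms -/

/-- The local conditions on a subterm of a candidate term. -/
structure EATerm.Local (Q : EATerm) : Prop where
  not_redex : ¬ Redex Q
  contr : ∀ M N, Q = .contr M N → (∃ i, N = .var i) ∧ 0 ∈ M.FV ∧ 1 ∈ M.FV
  prom : ∀ n R N, Q = .prom n R N → ∀ i, R ≠ .var i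

/-- `P` is an elementary term of type `T` that realizes the skeleton `D`, where the free
occurrence `y` becomes the variable `ρ y`. -/
structure Realizes (D : Skel) (Γ : ℕ → ℕ × Ty) (T : Ty) (ρ : ℕ → ℕ) (P : EATerm) : Prop where
  isLocal : ∀ Q, EATerm.Subterm Q P → Q.Local
  legal : P.Legal
  length_eq : P.length = D.len
  star_eq : P.star = Skel.er (fun y => .var (ρ y)) D
  FV_eq : P.FV = ρ '' D.fv
  typed : ∀ Ξ : Ctx, (∀ y ∈ D.fv, Ξ (ρ y) = some (Γ y).2) → NEAL Ξ P T

theorem Realizes.candidate {D : Skel} {Γ : ℕ → ℕ × Ty} {T : Ty} {ρ : ℕ → ℕ} {P : EATerm}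
    (h : Realizes D Γ T ρ P) : P.Candidate where
  legal := h.legal
  normal Q hQ := (h.isLocal Q hQ).not_redex
  simple := by
    refine ⟨fun M N hQ => ?_, ?_⟩
    · obtain ⟨⟨i, rfl⟩, -⟩ := (h.isLocal _ hQ).contr M N rfl
      exact ⟨i, rfl⟩
    · rw [h.length_eq, h.star_eq, Skel.length_er _ _ fun _ => rfl]
  contr_mem R Q hQ := ((h.isLocal _ hQ).contr R Q rfl).2
  prom_ne_var n R Q hQ := (h.isLocal _ hQ).prom n R Q rfl

theorem Realizes.leaf (y : ℕ) (Γ : ℕ → ℕ × Ty) (ρ : ℕ → ℕ) :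
    Realizes (.leaf y) Γ (Γ y).2 ρ (.var (ρ y)) where
  isLocal Q hQ := by
    cases hQ
    exact ⟨nofun, nofun, nofun⟩
  legal := trivial
  length_eq := rfl
  star_eq := rfl
  FV_eq := by simp [EATerm.FV, Skel.fv]
  typed Ξ h := .ax (h y (Finset.mem_singleton_self y))

/-- The hypothesis `hP` excludes the redex that moves a contraction out of an abstraction: a
contraction at the root of the body has to contract the bound variable. -/
theorem Realizes.lam {D : Skel} {Γ : ℕ → ℕ × Ty} {S : Finset ℕ} {a : ℕ} {A B : Ty} {ρ : ℕ → ℕ}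
    {P : EATerm}
    (h : Realizes D (extEnv Γ S a A) B (fun y => if y ∈ S then 0 else ρ y + 1) P)
    (hP : ∀ M N, P = .contr M N → N = .var 0) :
    Realizes (.lam S D) Γ (.lolli A B) ρ (.lam P) where
  isLocal Q hQ := by
    cases hQ with
    | refl =>
      refine ⟨fun hr => ?_, nofun, nofun⟩
      cases hr with
      | lamContr M N h0 =>
        rw [hP M N rfl] at h0
        exact h0 rfl
    | lam hQ => exact h.isLocal Q hQ
  legal := h.legal
  length_eq := by simp [EATerm.length, Skel.len, h.length_eq]
  star_eq := by
    simp only [EATerm.star, Skel.er, h.star_eq]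
    congr 2
    funext y
    unfold Skel.lift
    split_ifs <;> rfl
  FV_eq := by
    ext i
    simp only [EATerm.FV, h.FV_eq, Skel.fv, Set.mem_ofPred_eq, Set.mem_image, Finset.mem_coe,
      Finset.mem_sdiff]
    constructor
    · rintro ⟨y, hy, e⟩
      split_ifs at e with hS
      exact ⟨y, ⟨hy, hS⟩, by omega⟩
    · rintro ⟨y, ⟨hy, hS⟩, rfl⟩
      exact ⟨y, hy, if_neg hS⟩
  typed Ξ hΞ := by
    refine .lam (h.typed _ fun y hy => ?_)
    unfold extEnv
    split_ifs with hS
    · rfl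
    · exact hΞ y (Finset.mem_sdiff.2 ⟨hy, hS⟩)

theorem Realizes.app {D E : Skel} {Γ : ℕ → ℕ × Ty} {A B : Ty} {ρ : ℕ → ℕ} {P Q : EATerm}
    (hd : Disjoint D.fv E.fv) (hρ : Set.InjOn ρ (Skel.app D E).fv)
    (hP : Realizes D Γ (.lolli A B) ρ P) (hQ : Realizes E Γ A ρ Q)
    (hP' : ∀ M N, P ≠ .contr M N) (hQ' : ∀ M N, Q ≠ .contr M N) :
    Realizes (.app D E) Γ B ρ (.app P Q) := by
  have hdis : ∀ y ∈ D.fv, ∀ z ∈ E.fv, ρ y ≠ ρ z := fun y hy z hz e =>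
    Finset.disjoint_iff_ne.1 hd y hy z hz
      (hρ (Finset.mem_coe.2 (Finset.mem_union_left _ hy))
        (Finset.mem_coe.2 (Finset.mem_union_right _ hz)) e)
  constructor
  · intro R hR
    cases hR with
    | refl =>
      refine ⟨fun hr => ?_, nofun, nofun⟩
      cases hr with
      | appContrL M M₁ => exact hP' _ _ rfl
      | appContrR M N => exact hQ' _ _ rfl
    | appL hR => exact hP.isLocal R hR
    | appR hR => exact hQ.isLocal R hR
  · refine ⟨hP.legal, hQ.legal, ?_⟩
    rw [hP.FV_eq, hQ.FV_eq, Set.disjoint_left]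
    rintro _ ⟨y, hy, rfl⟩ ⟨z, hz, e⟩
    exact hdis y hy z hz e.symm
  · simp [EATerm.length, Skel.len, hP.length_eq, hQ.length_eq]
  · simp [EATerm.star, Skel.er, hP.star_eq, hQ.star_eq]
  · simp [EATerm.FV, Skel.fv, hP.FV_eq, hQ.FV_eq, Set.image_union]
  · intro Ξ hΞ
    refine .app (Ξ.isUnion_restrict_compl (ρ '' D.fv)) (hP.typed _ fun y hy => ?_)
      (hQ.typed _ fun y hy => ?_)
    · rw [Ctx.restrict_of_mem (Set.mem_image_of_mem ρ hy)]
      exact hΞ y (Finset.mem_union_left _ hy)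
    · rw [Ctx.restrict_of_mem]
      · exact hΞ y (Finset.mem_union_right _ hy)
      · rintro ⟨z, hz, e⟩
        exact hdis z hz y hy e

/-- Identification of free occurrences by means of contractions. -/
theorem exists_realizes_of_injOn {D : Skel} {Γ : ℕ → ℕ × Ty} {T : Ty}
    (h : ∀ ρ : ℕ → ℕ, Set.InjOn ρ D.fv → ∃ P, Realizes D Γ T ρ P ∧ ∀ M N, P ≠ .contr M N)
    (ρ : ℕ → ℕ) (hρ : ∀ y ∈ D.fv, ∀ z ∈ D.fv, y ≠ z → ρ y = ρ z →
      (Γ y).2 = (Γ z).2 ∧ ∃ A, (Γ y).2 = .bang A) :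
    ∃ P, Realizes D Γ T ρ P ∧ ∀ M N, P = .contr M N →
      ∃ y ∈ D.fv, ∃ z ∈ D.fv, y ≠ z ∧ ρ y = ρ z ∧ N = .var (ρ y) := by
  obtain ⟨k, hk⟩ : ∃ k, D.fv.card - (D.fv.image ρ).card = k := ⟨_, rfl⟩
  induction k using Nat.strong_induction_on generalizing ρ with
  | _ k ih =>
  by_cases hinj : Set.InjOn ρ D.fv
  · obtain ⟨P, hP, hP'⟩ := h ρ hinj
    exact ⟨P, hP, fun M N e => absurd e (hP' M N)⟩
  · simp only [Set.InjOn, not_forall, Finset.mem_coe] at hinj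
    obtain ⟨y, hy, z, hz, e, hyz⟩ := hinj
    -- One occurrence `y` is detached from its class and becomes index 0. The rest of the class
    -- shares index 1, to be contracted further by the recursive call if necessary; all other
    -- variables move past the two new indices. The map `f` is the substitution performed by the
    -- contraction, and it undoes `ρ'`.
    set f : ℕ → ℕ := fun i => if i < 2 then ρ y else i - 2 with hf
    set ρ' : ℕ → ℕ := fun x => if x = y then 0 else if ρ x = ρ y then 1 else ρ x + 2 with hρ'
    have hfρ : ∀ x, f (ρ' x) = ρ x := by
      intro x
      simp only [hf, hρ']
      split_ifs <;> first | omega | simp_all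
    have hy0 : ρ' y = 0 := by simp [hρ']
    have hz1 : ρ' z = 1 := by simp [hρ', Ne.symm hyz, e]
    have himg : D.fv.image ρ = (D.fv.image ρ').image f := by
      rw [Finset.image_image]
      exact Finset.image_congr fun x _ => (hfρ x).symm
    -- Both 0 and 1 occur in the image of `ρ'` and `f` merges them, so the image has grown and the
    -- measure decreases.
    have hlt : (D.fv.image ρ).card < (D.fv.image ρ').card := by
      rw [himg]
      refine lt_of_le_of_ne Finset.card_image_le fun hcard => ?_
      have := Finset.card_image_iff.1 hcard
        (Finset.mem_coe.2 (Finset.mem_image_of_mem ρ' hy))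
        (Finset.mem_coe.2 (Finset.mem_image_of_mem ρ' hz)) (by rw [hfρ, hfρ, e])
      omega
    have hle : (D.fv.image ρ').card ≤ D.fv.card := Finset.card_image_le
    obtain ⟨P, hP, -⟩ := ih (D.fv.card - (D.fv.image ρ').card) (by omega) ρ'
      (fun u hu v hv huv e => hρ u hu v hv huv (by rw [← hfρ u, ← hfρ v, e])) rfl
    have h0 : 0 ∈ P.FV := by rw [hP.FV_eq]; exact ⟨y, hy, hy0⟩
    have h1 : 1 ∈ P.FV := by rw [hP.FV_eq]; exact ⟨z, hz, hz1⟩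
    have hshift : ∀ x, x + 2 ∈ P.FV ↔ x ≠ ρ y ∧ x ∈ ρ '' D.fv := by
      intro x
      rw [hP.FV_eq]
      constructor
      · rintro ⟨u, hu, e⟩
        have hx : ρ u = x := by rw [← hfρ u, e]; simp [hf]
        refine ⟨?_, u, hu, hx⟩
        rintro rfl
        simp only [hρ'] at e
        split_ifs at e
        omega
      · rintro ⟨hx, u, hu, rfl⟩
        refine ⟨u, hu, ?_⟩
        simp only [hρ']
        rw [if_neg (fun h => hx (by rw [h])), if_neg hx]
    refine ⟨.contr P (.var (ρ y)), ⟨?_, ?_, ?_, ?_, ?_, ?_⟩, ?_⟩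
    · intro Q hQ
      cases hQ with
      | refl =>
        refine ⟨nofun, ?_, nofun⟩
        rintro M N ⟨⟩
        exact ⟨⟨_, rfl⟩, h0, h1⟩
      | contrBody hQ => exact hP.isLocal Q hQ
      | contrArg hQ =>
        cases hQ
        exact ⟨nofun, nofun, nofun⟩
    · refine ⟨hP.legal, trivial, ?_⟩
      rw [Set.disjoint_left]
      intro x hx hx'
      exact ((hshift x).1 hx).1 hx'
    · simp [EATerm.length, hP.length_eq]
    · simp only [EATerm.star, hP.star_eq]
      rw [Skel.er_subst]
      congr 1
      funext x
      simp only [Lam.subst]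
      rw [← hfρ x]
      simp only [hf]
      split_ifs <;> rfl
    · ext x
      simp only [EATerm.FV, Set.mem_union, Set.mem_ofPred_eq, hshift, Set.mem_singleton_iff]
      constructor
      · rintro (⟨_, hx⟩ | rfl)
        · exact hx
        · exact ⟨y, hy, rfl⟩
      · intro hx
        by_cases e : x = ρ y
        · exact .inr e
        · exact .inl ⟨e, hx⟩
    · intro Ξ hΞ
      obtain ⟨A, hA⟩ := (hρ y hy z hz hyz e).2
      refine .contr (A := A) (Ξ.isUnion_restrict_compl {ρ y}) (.ax ?_) (hP.typed _ fun u hu => ?_)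
      · rw [Ctx.restrict_of_mem (Set.mem_singleton _), hΞ y hy, hA]
      · simp only [hρ']
        split_ifs with h₁ h₂
        · rw [h₁, hA]; rfl
        · rw [(hρ u hu y hy h₁ h₂).1, hA]; rfl
        · change Ctx.restrict Ξ _ (ρ u) = _
          rw [Ctx.restrict_of_mem h₂, hΞ u hu]
    · rintro M N ⟨⟩
      exact ⟨y, hy, z, hz, hyz, e, rfl⟩

/-- A box around a term that realizes what remains of a skeleton after a cut. -/
theorem IsCut.realizes_prom {D D' : Skel} {Γ Γ' : ℕ → ℕ × Ty} {Ds : List (Skel × Ty)} {B : Ty}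
    {ρ ρ' : ℕ → ℕ} {P : EATerm} {Q : Fin Ds.length → EATerm} (h : IsCut Γ D D' Ds)
    (hlev : ∀ y ∈ D.fv, (Γ y).1 = 0) (hρ : Set.InjOn ρ D.fv)
    (hρ' : ∀ k : Fin Ds.length, ρ' Ds[k].1.name = k)
    (hΓ' : ∀ p ∈ Ds, Γ' p.1.name = (0, p.2))
    (hP : Realizes D' Γ' B ρ' P) (hPv : ∀ i, P ≠ .var i)
    (hQ : ∀ k : Fin Ds.length, Realizes Ds[k].1 Γ (.bang Ds[k].2) ρ (Q k))
    (hQc : ∀ k M N, Q k ≠ .contr M N) (hQp : ∀ k n M N, Q k ≠ .prom n M N) :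
    Realizes D Γ (.bang B) ρ (.prom Ds.length P Q) := by
  have hmem : ∀ y, y ∈ D'.fv ↔ ∃ k : Fin Ds.length, Ds[k].1.name = y := by
    intro y
    rw [h.mem_fv]
    constructor
    · rintro (⟨hy, hy'⟩ | ⟨p, hp, rfl⟩)
      · have := hlev y hy
        omega
      · obtain ⟨k, hk, rfl⟩ := List.getElem_of_mem hp
        exact ⟨⟨k, hk⟩, rfl⟩
    · rintro ⟨k, rfl⟩
      exact .inr ⟨_, List.getElem_mem _, rfl⟩
  have hdis : ∀ k l : Fin Ds.length, ∀ y ∈ Ds[k].1.fv, ∀ z ∈ Ds[l].1.fv, ρ y = ρ z → k = l := by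
    intro k l y hy z hz e
    have e := hρ (h.piece_fv _ (List.getElem_mem _) y hy).1
      (h.piece_fv _ (List.getElem_mem _) z hz).1 e
    subst e
    by_contra hkl
    have hp := List.pairwise_iff_getElem.1 h.pairwise
    rcases lt_or_gt_of_ne hkl with hkl | hkl
    · exact Finset.disjoint_left.1 (hp k l k.2 l.2 hkl) (Skel.fv_subset_leaves _ hy)
        (Skel.fv_subset_leaves _ hz)
    · exact Finset.disjoint_left.1 (hp l k l.2 k.2 hkl) (Skel.fv_subset_leaves _ hz)
        (Skel.fv_subset_leaves _ hy)
  have hFV : P.FV = {i | i < Ds.length} := by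
    ext i
    simp only [hP.FV_eq, Set.mem_image, Finset.mem_coe, hmem, Set.mem_ofPred_eq]
    constructor
    · rintro ⟨_, ⟨k, rfl⟩, rfl⟩
      rw [hρ']
      exact k.2
    · intro hi
      exact ⟨_, ⟨⟨i, hi⟩, rfl⟩, hρ' ⟨i, hi⟩⟩
  constructor
  · intro R hR
    cases hR with
    | refl =>
      refine ⟨fun hr => ?_, nofun, ?_⟩
      · cases hr with
        | bangBang _ _ _ k _ _ _ e => exact hQp k _ _ _ e
        | bangContr _ _ _ k _ _ e => exact hQc k _ _ e
      · rintro n R N ⟨⟩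
        exact hPv
    | promBody hR => exact hP.isLocal R hR
    | promArg k hR => exact (hQ k).isLocal R hR
  · refine ⟨hP.legal, fun k => (hQ k).legal, hFV, fun k l hkl => ?_⟩
    rw [(hQ k).FV_eq, (hQ l).FV_eq, Set.disjoint_left]
    rintro _ ⟨y, hy, rfl⟩ ⟨z, hz, e⟩
    exact hkl (hdis k l y hy z hz e.symm)
  · simp only [EATerm.length, hP.length_eq, h.len_eq, (hQ _).length_eq]
    congr 1
    exact Fin.sum_univ_fun_getElem Ds fun p => p.1.len
  · simp only [EATerm.star, hP.star_eq]
    rw [Skel.er_subst]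
    refine h.er_eq _ _ (fun y hy hy' => ?_) fun p hp => ?_
    · have := hlev y hy
      omega
    · obtain ⟨k, hk, rfl⟩ := List.getElem_of_mem hp
      simp only [Lam.subst]
      have e := hρ' ⟨k, hk⟩
      simp only [Fin.getElem_fin] at e
      rw [e, dif_pos hk, (hQ _).star_eq]
      rfl
  · ext x
    simp only [EATerm.FV, hFV, Set.mem_union, Set.mem_iUnion, Set.mem_ofPred_eq, (hQ _).FV_eq]
    constructor
    · rintro (⟨k, y, hy, rfl⟩ | hx)
      · exact ⟨y, (h.piece_fv _ (List.getElem_mem _) y hy).1, rfl⟩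
      · omega
    · rintro ⟨y, hy, rfl⟩
      obtain ⟨p, hp, hyp⟩ := h.cover y hy (hlev y hy)
      obtain ⟨k, hk, rfl⟩ := List.getElem_of_mem hp
      exact .inl ⟨⟨k, hk⟩, y, hyp, rfl⟩
  · intro Ξ hΞ
    -- Each argument receives the variables of its own piece. The variables of no piece go to the
    -- extra base of the promotion rule, where they are weakened.
    let s : Option (Fin Ds.length) → Set ℕ := fun k =>
      k.elim {x | ∀ k : Fin Ds.length, x ∉ ρ '' Ds[k].1.fv} fun k => ρ '' Ds[k].1.fv
    refine .prom (Γ := Ξ.restrict (s none)) (Δ := fun k => Ξ.restrict (s (some k)))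
      (A := fun k => Ds[k].2) ?_ (fun k => (hQ k).typed _ fun y hy => ?_) (hP.typed _ fun y hy => ?_)
    · have := Ξ.isUnion_restrict s ?_ ?_
      · convert this using 1
        funext k
        cases k <;> rfl
      · rintro (_ | k) (_ | l) x hk hl
        · rfl
        · exact absurd hl (hk l)
        · exact absurd hk (hl k)
        · obtain ⟨y, hy, rfl⟩ := hk
          obtain ⟨z, hz, e⟩ := hl
          rw [hdis k l y hy z hz e.symm]
      · intro x
        by_cases hx : ∃ k : Fin Ds.length, x ∈ ρ '' Ds[k].1.fv
        · exact ⟨some hx.choose, hx.choose_spec⟩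
        · exact ⟨none, fun k hk => hx ⟨k, hk⟩⟩
    · rw [Ctx.restrict_of_mem (show ρ y ∈ s (some k) from ⟨y, hy, rfl⟩)]
      exact hΞ y (h.piece_fv _ (List.getElem_mem _) y hy).1
    · obtain ⟨k, rfl⟩ := (hmem y).1 hy
      rw [hρ', dif_pos k.2, hΓ' Ds[k] (List.getElem_mem _)]

/-- Every skeleton with a levelled typing is realized by an elementary term. -/
theorem LTyped.exists_realizes (n a : ℕ) {D : Skel} {Γ : ℕ → ℕ × Ty} {A : Ty}
    (hn : D.len ≤ n) (hD : LTyped a Γ D A) (hl : D.Lin) (hlev : ∀ y ∈ D.fv, (Γ y).1 = 0)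
    (hv : ∀ y, D = .leaf y → a = 0) {ρ : ℕ → ℕ} (hρ : Set.InjOn ρ D.fv) :
    ∃ P, Realizes D Γ (Ty.bang^[a] A) ρ P ∧ (∀ M N, P ≠ .contr M N) ∧
      (a = 0 → ∀ n M N, P ≠ .prom n M N) ∧ (D.len ≠ 0 → ∀ i, P ≠ .var i) := by
  induction n using Nat.strong_induction_on generalizing a D Γ A ρ with
  | _ n ihn =>
  induction a generalizing D Γ A ρ with
  | zero =>
    cases hD with
    | @leaf _ _ y _ hy h =>
      refine ⟨.var (ρ y), ?_, nofun, fun _ => nofun, fun h => absurd rfl h⟩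
      have := Realizes.leaf y Γ ρ
      rwa [h, Nat.zero_sub] at this
    | @lam _ a' _ S D A B B' hlev' hD hB hvD hc =>
      have hlevS : ∀ y ∈ D.fv, (extEnv Γ S 0 A y).1 = 0 := by
        intro y hy
        unfold extEnv
        split_ifs with hS
        · rfl
        · exact hlev y (Finset.mem_sdiff.2 ⟨hy, hS⟩)
      -- The body is realized first with all occurrences distinct, including the boxes around it;
      -- contractions then send the bound ones to index 0. Since `ρ` is injective, identifications
      -- happen only within `S`, where `hc` supplies the modality.
      obtain ⟨P, hP, hP'⟩ := exists_realizes_of_injOn (D := D) (Γ := extEnv Γ S 0 A)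
        (T := Ty.bang^[a'] B') (fun ρ' hρ' => by
          obtain ⟨P, hP, hPc, -⟩ := ihn D.len (by simp only [Skel.len] at hn; omega) a' le_rfl hD
            hl.2 hlevS (fun y hy => Nat.le_zero.1 (hvD y hy)) hρ'
          exact ⟨P, hP, hPc⟩) (fun y => if y ∈ S then 0 else ρ y + 1) (by
          intro y hy z hz hyz e
          split_ifs at e with h₁ h₂ h₂
          · simp only [extEnv, h₁, h₂, if_true, true_and]
            exact hc (Finset.one_lt_card.2 ⟨y, h₁, z, h₂, hyz⟩)
          · exact absurd (hρ (Finset.mem_coe.2 (Finset.mem_sdiff.2 ⟨hy, h₁⟩))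
              (Finset.mem_coe.2 (Finset.mem_sdiff.2 ⟨hz, h₂⟩)) (Nat.succ.inj e)) hyz)
      rw [hB] at hP
      refine ⟨.lam P, hP.lam fun M N hMN => ?_, nofun, fun _ => nofun, fun _ => nofun⟩
      obtain ⟨y, hy, z, hz, hyz, e, rfl⟩ := hP' M N hMN
      clear hMN
      split_ifs at e with h₁ h₂ h₂
      · rw [if_pos h₁]
      · exact absurd (hρ (Finset.mem_coe.2 (Finset.mem_sdiff.2 ⟨hy, h₁⟩))
          (Finset.mem_coe.2 (Finset.mem_sdiff.2 ⟨hz, h₂⟩)) (Nat.succ.inj e)) hyz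
    | @app _ a₁ a₂ _ D E A' A B' B hlev' hD hA hE hB hvD hvE =>
      -- A linear implication is not modal, so no box opens around the function part; at level 0
      -- none can close either.
      have ha₁ := bang_iterate_eq_lolli hA
      subst ha₁
      simp only [Skel.len] at hn
      obtain ⟨P, hP, hPc, -⟩ := ihn D.len (by omega) 0 le_rfl hD hl.2.1
        (fun y hy => hlev y (Finset.mem_union_left _ hy)) (fun _ _ => rfl)
        (hρ.mono (Finset.coe_subset.2 Finset.subset_union_left))
      obtain ⟨Q, hQ, hQc, -⟩ := ihn E.len (by omega) a₂ le_rfl hE hl.2.2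
        (fun y hy => hlev y (Finset.mem_union_right _ hy)) (fun y hy => Nat.le_zero.1 (hvE y hy))
        (hρ.mono (Finset.coe_subset.2 Finset.subset_union_right))
      rw [hA] at hP
      rw [hB] at hQ
      exact ⟨.app P Q, hP.app (hl.1.mono D.fv_subset_leaves E.fv_subset_leaves) hρ hQ hPc hQc,
        nofun, fun _ => nofun, fun _ => nofun⟩
  | succ a iha =>
    obtain ⟨D', Ds, hcut, h0, ht⟩ := hD.cut a rfl hl
    have hD0 : D.len ≠ 0 := by
      cases D with
      | leaf y => exact absurd (hv y rfl) (Nat.succ_ne_zero a)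
      | lam S D => simp [Skel.len]
      | app D E => simp [Skel.len]
    -- The body thus contains an abstraction or application. By `len_eq` every piece is strictly
    -- shorter than `D`, so the outer induction covers the pieces, while the body is covered by the
    -- induction on the level.
    have hD'0 : D'.len ≠ 0 := fun h => hD0 (h0 h)
    have hlen := hcut.len_eq
    set ν : List ℕ := Ds.map fun p => p.1.name with hν
    have hnd : ν.Nodup := by
      refine List.pairwise_map.2 (hcut.pairwise.imp fun {p q} hpq e => ?_)
      exact Finset.disjoint_left.1 hpq p.1.name_mem_leaves (e ▸ q.1.name_mem_leaves)
    have hidx : ∀ k : Fin Ds.length, ν.idxOf Ds[k].1.name = k := by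
      intro k
      have := hnd.idxOf_getElem k (by simp [hν])
      simpa [hν] using this
    -- Since all of `D` is declared at level 0, only names of pieces are free in `D'`; the default
    -- `.o` is never used.
    set Γ' : ℕ → ℕ × Ty := fun y => (0, (Ds[ν.idxOf y]?.map Prod.snd).getD .o) with hΓ'
    have hΓD : ∀ p ∈ Ds, Γ' p.1.name = (0, p.2) := by
      intro p hp
      obtain ⟨k, hk, rfl⟩ := List.getElem_of_mem hp
      have e := hidx ⟨k, hk⟩
      simp only [Fin.getElem_fin] at e
      simp [hΓ', e, hk]
    obtain ⟨P, hP, -, -, hPv⟩ := iha (ρ := fun y => ν.idxOf y) (by omega)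
      (ht Γ' ⟨fun y hy h => absurd (hlev y hy) (by omega), hΓD⟩) hcut.lin (fun _ _ => rfl)
      (by rintro y rfl; exact absurd rfl hD'0) (by
        intro y hy z hz e
        have hm : ∀ y ∈ D'.fv, y ∈ ν := by
          intro y hy
          rcases (hcut.mem_fv y).1 hy with ⟨hy, h⟩ | ⟨p, hp, rfl⟩
          · exact absurd (hlev y hy) (by omega)
          · exact List.mem_map.2 ⟨p, hp, rfl⟩
        exact (List.idxOf_inj (hm y hy)).1 e)
    have hQ : ∀ k : Fin Ds.length, ∃ Q, Realizes Ds[k].1 Γ (.bang Ds[k].2) ρ Q ∧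
        (∀ M N, Q ≠ .contr M N) ∧ ∀ n M N, Q ≠ .prom n M N := by
      intro k
      have hk : Ds[k] ∈ Ds := List.getElem_mem _
      have hle : Ds[k].1.len ≤ (Ds.map fun p => p.1.len).sum :=
        List.le_sum_of_mem (List.mem_map.2 ⟨_, hk, rfl⟩)
      -- Level 0 is what ensures that the argument is not itself a box.
      obtain ⟨Q, hQ, hQc, hQp, -⟩ := ihn Ds[k].1.len (by omega) 0 le_rfl
        (hcut.piece_typed _ hk) (hcut.piece_lin _ hk) (fun y hy => (hcut.piece_fv _ hk y hy).2)
        (fun _ _ => rfl) (hρ.mono fun y hy => (hcut.piece_fv _ hk y hy).1)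
      exact ⟨Q, hQ, hQc, hQp rfl⟩
    choose Q hQ hQc hQp using hQ
    rw [Function.iterate_succ_apply']
    exact ⟨_, hcut.realizes_prom hlev hρ hidx hΓD hP (hPv hD'0) hQ hQc hQp, nofun,
      fun h => absurd h (Nat.succ_ne_zero a), fun _ => nofun⟩

/-! ### Computations with fresh names -/

theorem Fresh.bind_eq_some {α β : Type} {x : Fresh α} {f : α → Fresh β} {n m : ℕ} {b : β} :
    (x >>= f) n = some (b, m) ↔ ∃ a k, x n = some (a, k) ∧ f a k = some (b, m) := by
  change Option.bind (x n) (fun p => f p.1 p.2) = _ ↔ _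
  rw [Option.bind_eq_some_iff]
  simp [Prod.exists]

theorem Fresh.pure_eq_some {α : Type} {a b : α} {n m : ℕ} :
    (pure a : Fresh α) n = some (b, m) ↔ a = b ∧ n = m := by
  change some (a, n) = _ ↔ _
  simp

theorem Fresh.lift_eq_some {α : Type} {o : Option α} {b : α} {n m : ℕ} :
    (liftM o : Fresh α) n = some (b, m) ↔ o = some b ∧ n = m := by
  change Option.bind o (fun a => some (a, n)) = _ ↔ _
  cases o <;> simp

theorem fresh_eq_some {n m k : ℕ} : fresh n = some (k, m) ↔ n = k ∧ n + 1 = m := by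
  simp [fresh]

theorem process_lt {σ : STy} {n m : ℕ} {Θ : GTy} (h : process σ n = some (Θ, m)) : n < m := by
  induction σ generalizing n m Θ with
  | o =>
    simp only [process, Fresh.bind_eq_some, Fresh.pure_eq_some, fresh_eq_some] at h
    obtain ⟨_, _, ⟨rfl, rfl⟩, _, rfl⟩ := h
    omega
  | arr σ τ ihσ ihτ =>
    simp only [process, Fresh.bind_eq_some, Fresh.pure_eq_some, fresh_eq_some] at h
    obtain ⟨_, _, ⟨rfl, rfl⟩, _, _, h₁, _, _, h₂, _, rfl⟩ := h
    have := ihσ h₁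
    have := ihτ h₂
    omega

theorem nameRows_spec {cs : List Constr} {n m : ℕ} {rs : List Row}
    (h : nameRows cs n = some (rs, m)) :
    n ≤ m ∧ rs.map Row.constr = cs ∧ ∀ r ∈ rs, n ≤ r.name ∧ r.name < m := by
  induction cs generalizing n m rs with
  | nil =>
    simp only [nameRows, Fresh.pure_eq_some] at h
    obtain ⟨rfl, rfl⟩ := h
    simp
  | cons c cs ih =>
    simp only [nameRows, Fresh.bind_eq_some, Fresh.pure_eq_some, fresh_eq_some] at h
    obtain ⟨_, _, ⟨rfl, rfl⟩, rs, _, h, rfl, rfl⟩ := h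
    obtain ⟨h₁, h₂, h₃⟩ := ih h
    refine ⟨by omega, by simp [h₂], ?_⟩
    rintro r (_ | ⟨_, hr⟩)
    · simp only
      omega
    · have := h₃ r hr
      omega

/-! ### Instances of types and shifted constraints -/

theorem GTy.inst_bang (X : ℕ → ℕ) (n : ℕ) (Θ : GTy) :
    (Θ.bang n).inst X = Ty.bang^[X n] (Θ.inst X) := by
  cases Θ <;> simp [GTy.bang, GTy.inst, Expo.eval, Function.iterate_add_apply]

theorem GTy.inst_eq_setExpo (X : ℕ → ℕ) (n k : ℕ) (Θ : GTy)
    (h : Expo.eval X Θ.expo = X n + k) : Θ.inst X = Ty.bang^[k] ((Θ.setExpo n).inst X) := by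
  cases Θ <;>
    simp only [GTy.expo] at h <;>
    simp only [GTy.setExpo, GTy.inst, h, ← Function.iterate_add_apply] <;>
    simp [Expo.eval, Nat.add_comm]

theorem GTy.inst_eq_bang (X : ℕ → ℕ) (Θ : GTy) (h : 1 ≤ Expo.eval X Θ.expo) :
    ∃ A, Θ.inst X = .bang A := by
  obtain ⟨k, hk⟩ := Nat.exists_eq_add_of_le' h
  cases Θ <;>
    simp only [GTy.expo] at hk <;>
    simp only [GTy.inst, hk, Function.iterate_succ_apply'] <;>
    exact ⟨_, rfl⟩

/-- The constraint holds after `k` has been subtracted from its left-hand side. -/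
def Constr.SatSub (X : ℕ → ℕ) (k : ℕ) : Constr → Prop
  | .eqZero e f => Expo.eval X e = Expo.eval X f + k
  | .geOne e => 1 ≤ Expo.eval X e

theorem Constr.satSub_zero {X : ℕ → ℕ} {c : Constr} : c.SatSub X 0 ↔ c.Sat X := by
  cases c <;> simp only [SatSub, Sat]
  omega

/-- One boxing step on a row is one increment of its shift; inequalities ignore both. -/
theorem Constr.satSub_sub {X : ℕ → ℕ} {k n : ℕ} {c : Constr} :
    (c.sub n).SatSub X k ↔ c.SatSub X (k + X n) := by
  cases c <;> simp only [SatSub, sub, Expo.eval, List.map_cons, List.sum_cons]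
  omega

/-- Only the constraint between the outermost exponents can belong to a critical point, so it alone
may be shifted. A shift by `k` leaves `k` additional modalities on the left-hand type; the inner
positions agree exactly. -/
theorem unify_spec {Θ Δ : GTy} {A : List Constr} (h : unify Θ Δ = some A) :
    ∃ A', A = .eqZero Θ.expo Δ.expo :: A' ∧ ∀ X k,
      Expo.eval X Θ.expo = Expo.eval X Δ.expo + k → (∀ c ∈ A', c.SatSub X 0) →
      Θ.inst X = Ty.bang^[k] (Δ.inst X) := by
  induction Θ generalizing Δ A with
  | base e =>
    cases Δ with
    | base f =>
      simp only [unify, Option.some.injEq] at h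
      subst h
      refine ⟨[], rfl, fun X k h _ => ?_⟩
      simp only [GTy.expo] at h
      simp [GTy.inst, h, ← Function.iterate_add_apply, Nat.add_comm]
    | arr f Δ₁ Δ₂ => simp [unify] at h
  | arr e Θ₁ Θ₂ ih₁ ih₂ =>
    cases Δ with
    | base f => simp [unify] at h
    | arr f Δ₁ Δ₂ =>
      simp only [unify, Option.bind_eq_bind, Option.bind_eq_some_iff, Option.some.injEq] at h
      obtain ⟨A₁, h₁, A₂, h₂, rfl⟩ := h
      refine ⟨_, rfl, fun X k h hA => ?_⟩
      obtain ⟨A₁', rfl, i₁⟩ := ih₁ h₁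
      obtain ⟨A₂', rfl, i₂⟩ := ih₂ h₂
      have e₁ := i₁ X 0 (hA (.eqZero Θ₁.expo Δ₁.expo) (by simp)) fun c hc => hA c (by simp [hc])
      have e₂ := i₂ X 0 (hA (.eqZero Θ₂.expo Δ₂.expo) (by simp)) fun c hc => hA c (by simp [hc])
      simp only [Function.iterate_zero, id_eq] at e₁ e₂
      simp only [GTy.expo] at h
      simp [GTy.inst, h, e₁, e₂, ← Function.iterate_add_apply, Nat.add_comm]

theorem unify_inst_eq {Θ Δ : GTy} {A : List Constr} (h : unify Θ Δ = some A) {X : ℕ → ℕ}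
    (hA : ∀ c ∈ A, c.SatSub X 0) : Θ.inst X = Δ.inst X := by
  obtain ⟨A', rfl, h'⟩ := unify_spec h
  exact h' X 0 (hA (.eqZero Θ.expo Δ.expo) (by simp)) fun c hc => hA c (by simp [hc])

theorem unifyAll_inst_eq {Θ : GTy} {Θs : List GTy} {A : List Constr}
    (h : unifyAll (Θ :: Θs) = some A) {X : ℕ → ℕ} (hA : ∀ c ∈ A, c.SatSub X 0) :
    ∀ Δ ∈ Θ :: Θs, Δ.inst X = Θ.inst X := by
  induction Θs generalizing Θ A with
  | nil => simp
  | cons Θ' Θs ih =>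
    simp only [unifyAll, Option.bind_eq_bind, Option.bind_eq_some_iff, Option.some.injEq] at h
    obtain ⟨A₁, h₁, A₂, h₂, rfl⟩ := h
    have e := unify_inst_eq h₁ fun c hc => hA c (by simp [hc])
    rintro Δ (_ | ⟨_, hΔ⟩)
    · rfl
    · rw [e]
      exact ih h₂ (fun c hc => hA c (by simp [hc])) Δ hΔ

theorem contract_inst {Θ : GTy} {Θs : List GTy} {A : List Constr}
    (h : contract (Θ :: Θs) = some A) {X : ℕ → ℕ} (hA : ∀ c ∈ A, c.SatSub X 0) :
    (∀ Δ ∈ Θ :: Θs, Δ.inst X = Θ.inst X) ∧ (Θs ≠ [] → ∃ B, Θ.inst X = .bang B) := by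
  cases Θs with
  | nil => simp
  | cons Θ' Θs =>
    simp only [contract, Option.bind_eq_bind, Option.bind_eq_some_iff, Option.some.injEq] at h
    obtain ⟨A', h', rfl⟩ := h
    exact ⟨unifyAll_inst_eq h' fun c hc => hA c (by simp [hc]),
      fun _ => GTy.inst_eq_bang X Θ (hA (.geOne Θ.expo) (by simp))⟩

/-! ### Weighted slices -/

/-- The total weight of the slices that satisfy `φ`, in a list of slices with weights. -/
def wt (φ : Slice → Bool) (w : List (Slice × ℕ)) : ℕ :=
  (w.map fun p => if φ p.1 then p.2 else 0).sum

theorem wt_cons (φ : Slice → Bool) (p : Slice × ℕ) (w : List (Slice × ℕ)) :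
    wt φ (p :: w) = (if φ p.1 then p.2 else 0) + wt φ w := rfl

theorem wt_append (φ : Slice → Bool) (w w' : List (Slice × ℕ)) :
    wt φ (w ++ w') = wt φ w + wt φ w' := by
  simp [wt]

theorem wt_eq_zero {φ : Slice → Bool} {w : List (Slice × ℕ)} (h : ∀ p ∈ w, φ p.1 = false) :
    wt φ w = 0 := by
  induction w with
  | nil => rfl
  | cons p w ih =>
    rw [wt_cons, h p (by simp), ih fun q hq => h q (by simp [hq])]
    rfl

theorem wt_le_total (φ : Slice → Bool) (w : List (Slice × ℕ)) :
    wt φ w ≤ wt (fun _ => true) w := by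
  induction w with
  | nil => exact le_rfl
  | cons p w ih =>
    rw [wt_cons, wt_cons]
    split_ifs <;> simp_all
    omega

/-- Isolates the weight `k` of the last slice, which in the applications is the critical point at
the root of a subterm. -/
theorem exists_wt_snoc {C : List Slice} {sl : Slice} {b : Bool} {w : List (Slice × ℕ)}
    (h : ∀ p ∈ w, p.1 ∈ if b then C ++ [sl] else C) :
    ∃ w' k, (∀ p ∈ w', p.1 ∈ C) ∧ (b = false → k = 0) ∧
      ∀ φ, wt φ w = wt φ w' + if φ sl then k else 0 := by
  induction w with
  | nil => exact ⟨[], 0, by simp, fun _ => rfl, by simp [wt]⟩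
  | cons p w ih =>
    obtain ⟨w', k, hC, hk, hφ⟩ := ih fun q hq => h q (by simp [hq])
    have hp := h p (by simp)
    by_cases hpC : p.1 ∈ C
    · refine ⟨p :: w', k, ?_, hk, fun φ => ?_⟩
      · rintro q (_ | ⟨_, hq⟩)
        exacts [hpC, hC q hq]
      · rw [wt_cons, wt_cons, hφ φ, Nat.add_assoc]
    · cases b with
      | false => exact absurd hp hpC
      | true =>
        have hp : p.1 = sl := by simpa [hpC] using hp
        refine ⟨w', k + p.2, hC, nofun, fun φ => ?_⟩
        rw [wt_cons, hφ φ, hp]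
        split_ifs <;> omega

theorem mem_prodUnion {C₁ C₂ : List Slice} {sl : Slice} (h : sl ∈ prodUnion C₁ C₂) :
    sl ∈ C₁ ∨ sl ∈ C₂ ∨ ∃ s ∈ C₁, ∃ t ∈ C₂, sl = s ++ t := by
  induction C₁ with
  | nil =>
    rw [prodUnion] at h
    exact .inr (.inl h)
  | cons s C₁ ih =>
    cases C₂ with
    | nil =>
      rw [prodUnion] at h
      · exact .inl h
      · simp
    | cons t C₂ =>
      rw [prodUnion] at h
      · rcases List.mem_append.1 h with h | h
        · rcases List.mem_cons.1 h with rfl | h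
          · exact .inl (by simp)
          · obtain ⟨u, hu, rfl⟩ := List.mem_map.1 h
            exact .inr (.inr ⟨s, by simp, u, hu, rfl⟩)
        · rcases ih h with h | h | ⟨u, hu, v, hv, rfl⟩
          · exact .inl (by simp [h])
          · exact .inr (.inl h)
          · exact .inr (.inr ⟨u, by simp [hu], v, hv, rfl⟩)
      · simp

/-- A joined slice passes its whole weight to both components, because its boxes surround the
application and close in both subterms. A slice from one side contributes nothing to the other, so
the totals only satisfy inequalities; but a property that never holds on one side has the same
weight in `w` as in the projection to the other. -/
theorem exists_wt_prodUnion {C₁ C₂ : List Slice} {w : List (Slice × ℕ)}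
    (h : ∀ p ∈ w, p.1 ∈ prodUnion C₁ C₂) :
    ∃ w₁ w₂, (∀ p ∈ w₁, p.1 ∈ C₁) ∧ (∀ p ∈ w₂, p.1 ∈ C₂) ∧
      wt (fun _ => true) w₁ ≤ wt (fun _ => true) w ∧
      wt (fun _ => true) w₂ ≤ wt (fun _ => true) w ∧
      ∀ φ : Slice → Bool, (∀ s t, φ (s ++ t) = (φ s || φ t)) →
        ((∀ s ∈ C₂, φ s = false) → wt φ w = wt φ w₁) ∧
        ((∀ s ∈ C₁, φ s = false) → wt φ w = wt φ w₂) := by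
  induction w with
  | nil => exact ⟨[], [], by simp, by simp, le_rfl, le_rfl, fun φ _ => ⟨fun _ => rfl, fun _ => rfl⟩⟩
  | cons p w ih =>
    obtain ⟨w₁, w₂, h₁, h₂, t₁, t₂, hφ⟩ := ih fun q hq => h q (by simp [hq])
    rcases mem_prodUnion (h p (by simp)) with hp | hp | ⟨s, hs, t, ht, hst⟩
    · refine ⟨p :: w₁, w₂, ?_, h₂, ?_, ?_, fun φ hadd => ⟨fun hC => ?_, fun hC => ?_⟩⟩
      · rintro q (_ | ⟨_, hq⟩)
        exacts [hp, h₁ q hq]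
      · simpa [wt_cons] using t₁
      · rw [wt_cons]; omega
      · rw [wt_cons, wt_cons, (hφ φ hadd).1 hC]
      · rw [wt_cons, hC _ hp, (hφ φ hadd).2 hC]; simp
    · refine ⟨w₁, p :: w₂, h₁, ?_, ?_, ?_, fun φ hadd => ⟨fun hC => ?_, fun hC => ?_⟩⟩
      · rintro q (_ | ⟨_, hq⟩)
        exacts [hp, h₂ q hq]
      · rw [wt_cons]; omega
      · simpa [wt_cons] using t₂
      · rw [wt_cons, hC _ hp, (hφ φ hadd).1 hC]; simp
      · rw [wt_cons, wt_cons, (hφ φ hadd).2 hC]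
    · refine ⟨(s, p.2) :: w₁, (t, p.2) :: w₂, ?_, ?_, ?_, ?_,
        fun φ hadd => ⟨fun hC => ?_, fun hC => ?_⟩⟩
      · rintro q (_ | ⟨_, hq⟩)
        exacts [hs, h₁ q hq]
      · rintro q (_ | ⟨_, hq⟩)
        exacts [ht, h₂ q hq]
      · simpa [wt_cons] using t₁
      · simpa [wt_cons] using t₂
      · rw [wt_cons, wt_cons, (hφ φ hadd).1 hC, hst, hadd, hC t ht, Bool.or_false]
      · rw [wt_cons, wt_cons, (hφ φ hadd).2 hC, hst, hadd, hC s hs, Bool.false_or]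

theorem Slice.hasRow_append (j : ℕ) (s t : Slice) :
    Slice.hasRow (s ++ t) j = (s.hasRow j || t.hasRow j) := List.any_append

theorem Slice.hasOcc_append (y : ℕ) (s t : Slice) :
    Slice.hasOcc (s ++ t) y = (s.hasOcc y || t.hasOcc y) := List.any_append

/-! ### The invariant of the type synthesis -/

/-- The rows hold, each shifted by the weight of the slices to which it belongs. -/
def RowsSat (X : ℕ → ℕ) (w : List (Slice × ℕ)) (A : List Row) : Prop :=
  ∀ r ∈ A, r.constr.SatSub X (wt (fun sl => sl.hasRow r.name) w)

/-- The environment `Γ` fits the base `B` of a term inside `a` boxes, of which those of the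
slices in `w` are closed at their critical points. -/
def EnvFits (X : ℕ → ℕ) (w : List (Slice × ℕ)) (a : ℕ) (B : List Entry) (Γ : ℕ → ℕ × Ty) : Prop :=
  ∀ e ∈ B, (Γ e.occ).1 + wt (fun sl => sl.hasOcc e.occ) w ≤ a ∧
    (Γ e.occ).2 = Ty.bang^[a - ((Γ e.occ).1 + wt (fun sl => sl.hasOcc e.occ) w)] (e.ty.inst X)

/-- A skeleton has the synthesized type, however boxes through the critical points are put
around it; `t` of the modalities of the type may stand for boxes around the skeleton. -/
def SynthTyped (X : ℕ → ℕ) (r : Result) (D : Skel) (P : ℕ → Prop) : Prop :=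
  ∀ w : List (Slice × ℕ), (∀ p ∈ w, p.1 ∈ r.cpts) → RowsSat X w r.rows →
    ∀ a Γ, wt (fun _ => true) w ≤ a → EnvFits X w a r.base Γ →
      ∃ t A, P t ∧ r.ty.inst X = Ty.bang^[t] A ∧ LTyped (a + t) Γ D A

/-- The part of the invariant that does not concern types. All names used in the synthesis
belong to the interval from `n` to `m`. -/
structure SynthShape (M : Lam) (n m : ℕ) (r : Result) (D : Skel) : Prop where
  le : n ≤ m
  mem_fv : ∀ y, y ∈ D.fv ↔ y ∈ fvo r.base
  nodup : (fvo r.base).Nodup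
  leaves : ∀ y ∈ D.leaves, n ≤ y ∧ y < m
  lin : D.Lin
  er_eq : ∀ ρ : ℕ → ℕ, (∀ e ∈ r.base, ρ e.occ = e.var) → Skel.er (fun y => .var (ρ y)) D = M
  isVar : ∀ y, D = .leaf y → M.isVar = true
  rows : ∀ q ∈ r.rows, n ≤ q.name ∧ q.name < m
  cpts : ∀ sl ∈ r.cpts, ∀ p ∈ sl, (n ≤ p.1 ∧ p.1 < m) ∧ ∀ y ∈ p.2, n ≤ y ∧ y < m

theorem SynthShape.occ_range {M : Lam} {n m : ℕ} {r : Result} {D : Skel}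
    (h : SynthShape M n m r D) : ∀ y ∈ fvo r.base, n ≤ y ∧ y < m :=
  fun y hy => h.leaves y (D.fv_subset_leaves ((h.mem_fv y).2 hy))

theorem Slice.hasRow_eq_false {sl : Slice} {j : ℕ} (h : ∀ p ∈ sl, p.1 ≠ j) :
    sl.hasRow j = false := by
  simpa [Slice.hasRow] using fun a b hp => h (a, b) hp

theorem Slice.hasOcc_eq_false {sl : Slice} {y : ℕ} (h : ∀ p ∈ sl, ∀ z ∈ p.2, z ≠ y) :
    sl.hasOcc y = false := by
  simpa [Slice.hasOcc] using fun a b hp hy => h (a, b) hp y hy rfl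

/-- Names are drawn from consecutive intervals, so a name from outside the interval cannot be
mentioned by the slices of this synthesis. -/
theorem SynthShape.hasRow_eq_false {M : Lam} {n m : ℕ} {r : Result} {D : Skel}
    (h : SynthShape M n m r D) {j : ℕ} (hj : j < n ∨ m ≤ j) : ∀ sl ∈ r.cpts, sl.hasRow j = false :=
  fun sl hsl => Slice.hasRow_eq_false fun p hp e => by
    have := (h.cpts sl hsl p hp).1
    omega

theorem SynthShape.hasOcc_eq_false {M : Lam} {n m : ℕ} {r : Result} {D : Skel}
    (h : SynthShape M n m r D) {y : ℕ} (hy : y < n ∨ m ≤ y) : ∀ sl ∈ r.cpts, sl.hasOcc y = false :=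
  fun sl hsl => Slice.hasOcc_eq_false fun p hp z hz e => by
    have := (h.cpts sl hsl p hp).2 z hz
    omega

/-! ### Boxing -/

/-- The witness `w` weights each slice by the value of its fresh variable. An occurrence gains a
modality for every new box except those of the slices containing it, whence the difference of
weights. -/
theorem boxSlices_spec (X : ℕ → ℕ) {cpts : List Slice} {B B' : List Entry} {Γ Γ' : GTy}
    {A A' : List Row} {n m : ℕ} (h : boxSlices cpts B Γ A n = some ((B', Γ', A'), m)) :
    ∃ w : List (Slice × ℕ), n ≤ m ∧ (∀ p ∈ w, p.1 ∈ cpts) ∧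
      Γ'.inst X = Ty.bang^[wt (fun _ => true) w] (Γ.inst X) ∧
      (∃ f : Entry → GTy, B' = B.map (fun e => { e with ty := f e }) ∧ ∀ e,
        (f e).inst X = Ty.bang^[wt (fun _ => true) w - wt (fun sl => sl.hasOcc e.occ) w]
          (e.ty.inst X)) ∧
      A'.map Row.name = A.map Row.name ∧
      ∀ w', RowsSat X w' A' → RowsSat X (w' ++ w) A := by
  induction cpts generalizing B Γ A n with
  | nil =>
    simp only [boxSlices, Fresh.pure_eq_some, Prod.mk.injEq] at h
    obtain ⟨⟨rfl, rfl, rfl⟩, rfl⟩ := h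
    exact ⟨[], le_rfl, by simp, rfl, ⟨Entry.ty, by simp, fun e => rfl⟩, rfl, by simp⟩
  | cons sl cpts ih =>
    simp only [boxSlices, Fresh.bind_eq_some, fresh_eq_some] at h
    obtain ⟨_, _, ⟨rfl, rfl⟩, h⟩ := h
    obtain ⟨w, hle, hw, hΓ, ⟨f, rfl, hf⟩, hnames, hrows⟩ := ih h
    refine ⟨(sl, X n) :: w, by omega, ?_, ?_, ?_, ?_, ?_⟩
    · rintro p (_ | ⟨_, hp⟩)
      · simp
      · simp [hw p hp]
    · rw [hΓ, GTy.inst_bang, wt_cons, if_pos rfl, ← Function.iterate_add_apply, Nat.add_comm]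
    · refine ⟨fun e => f (if sl.hasOcc e.occ then e else { e with ty := e.ty.bang n }), ?_, ?_⟩
      · rw [List.map_map]
        refine List.map_congr_left fun e _ => ?_
        simp only [Function.comp]
        split_ifs <;> rfl
      · intro e
        have hle := wt_le_total (fun sl => sl.hasOcc e.occ) w
        simp only [hf, wt_cons, if_true]
        split_ifs with hs
        · simp only [Nat.add_sub_add_left]
        · simp only [GTy.inst_bang, ← Function.iterate_add_apply]
          congr 1
          omega
    · rw [hnames, List.map_map]
      refine List.map_congr_left fun r _ => ?_
      simp only [Function.comp]
      split_ifs <;> rfl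
    · intro w' h' r hr
      have := hrows w' h' _ (List.mem_map_of_mem hr)
      rw [wt_append] at this ⊢
      rw [wt_cons]
      split_ifs at this ⊢ with hs
      · simp only [Constr.satSub_sub] at this
        convert this using 1
        omega
      · simpa using this

/-- The new boxes raise the level at which the unboxed invariant is used, and their weights are
appended to the ones still to come. The modalities in front of the type are then read as boxes,
which is why `t` may now be positive, though never on a variable. -/
theorem boxing_spec (X : ℕ → ℕ) {M : Lam} {n m k : ℕ} {r r' : Result} {D : Skel}
    (hs : SynthShape M n m r D) (ht : SynthTyped X r D fun t => t = 0)
    (h : boxing M r m = some (r', k)) :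
    SynthShape M n k r' D ∧ m ≤ k ∧ SynthTyped X r' D fun t => ∀ y, D = .leaf y → t = 0 := by
  unfold boxing at h
  split_ifs at h with hM
  · simp only [Fresh.pure_eq_some] at h
    obtain ⟨rfl, rfl⟩ := h
    refine ⟨hs, le_rfl, fun w hw hr a Γ ha hΓ => ?_⟩
    obtain ⟨t, A, rfl, h⟩ := ht w hw hr a Γ ha hΓ
    exact ⟨0, A, fun _ _ => rfl, h⟩
  · simp only [Fresh.bind_eq_some, Fresh.pure_eq_some, fresh_eq_some] at h
    obtain ⟨⟨B, Γ, A⟩, m', h, b, _, ⟨rfl, rfl⟩, rfl, rfl⟩ := h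
    obtain ⟨w, hle, hw, hΓ, ⟨f, rfl, hf⟩, hnames, hrows⟩ := boxSlices_spec X h
    have hocc : fvo ((r.base.map fun e => { e with ty := f e }).map
        fun e : Entry => { e with ty := e.ty.bang m' }) = fvo r.base := by
      simp [fvo, Function.comp_def]
    refine ⟨⟨by have := hs.le; omega, ?_, ?_, ?_, hs.lin, ?_, hs.isVar, ?_, ?_⟩, by omega, ?_⟩
    · simpa only [hocc] using hs.mem_fv
    · simpa only [hocc] using hs.nodup
    · intro y hy
      have := hs.leaves y hy
      omega
    · intro ρ hρ
      refine hs.er_eq ρ fun e he => ?_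
      have := hρ _ (List.mem_map_of_mem (List.mem_map_of_mem he))
      exact this
    · intro q hq
      have : q.name ∈ r.rows.map Row.name := hnames ▸ List.mem_map_of_mem hq
      obtain ⟨q', hq', e⟩ := List.mem_map.1 this
      have := hs.rows q' hq'
      omega
    · intro sl hsl p hp
      have := hs.cpts sl hsl p hp
      refine ⟨by omega, fun y hy => ?_⟩
      have := this.2 y hy
      omega
    · intro w' hw' hr a Δ ha hΔ
      -- `X m'` counts the boxes given by the final fresh variable `b`, and the total weight of `w`
      -- those passing through slices.
      have htot : wt (fun _ => true) (w' ++ w) ≤ a + (X m' + wt (fun _ => true) w) := by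
        rw [wt_append]
        omega
      obtain ⟨t, A₀, rfl, hA, hD⟩ := ht (w' ++ w)
        (fun p hp => (List.mem_append.1 hp).elim (hw' p) (hw p)) (hrows w' hr)
        (a + (X m' + wt (fun _ => true) w)) Δ htot (fun e he => by
          have h := hΔ _ (List.mem_map_of_mem (List.mem_map_of_mem he))
          simp only at h
          have hle := wt_le_total (fun sl => sl.hasOcc e.occ) w
          simp only [GTy.inst_bang, hf, ← Function.iterate_add_apply] at h
          refine ⟨?_, ?_⟩
          · rw [wt_append]
            omega
          · rw [h.2, wt_append]
            congr 1
            omega)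
      refine ⟨_, A₀, fun y hy => absurd (hs.isVar y hy) hM, ?_, hD⟩
      rw [GTy.inst_bang, hΓ, hA, ← Function.iterate_add_apply]
      rfl

theorem synthVar_spec (X : ℕ → ℕ) {i : ℕ} {σ : STy} {n m : ℕ} {r : Result}
    (h : synthVar i σ n = some (r, m)) :
    ∃ D, SynthShape (.var i) n m r D ∧ SynthTyped X r D fun t => t = 0 := by
  simp only [synthVar, Fresh.bind_eq_some, Fresh.pure_eq_some, fresh_eq_some] at h
  obtain ⟨Θ, k, hΘ, y, _, ⟨rfl, rfl⟩, rfl, rfl⟩ := h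
  have hle := process_lt hΘ
  refine ⟨.leaf k, ⟨by omega, ?_, ?_, ?_, trivial, ?_, fun _ _ => rfl, by simp, by simp⟩, ?_⟩
  · simp [Skel.fv, fvo]
  · simp [fvo]
  · intro y hy
    rw [Finset.mem_singleton.1 hy]
    omega
  · intro ρ hρ
    have := hρ _ (List.mem_singleton_self _)
    simp only at this
    simp only [Skel.er, this]
  · intro w hw _ a Γ _ hΓ
    obtain rfl : w = [] := List.eq_nil_iff_forall_not_mem.2 fun p hp => by simpa using hw p hp
    have := hΓ _ (List.mem_singleton_self _)
    exact ⟨0, _, rfl, rfl, .leaf this.1 this.2⟩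

/-! ### Abstractions -/

theorem SynthShape.occ_inj {M : Lam} {n m : ℕ} {r : Result} {D : Skel}
    (h : SynthShape M n m r D) {e e' : Entry} (he : e ∈ r.base) (he' : e' ∈ r.base)
    (hocc : e.occ = e'.occ) : e = e' :=
  List.inj_on_of_nodup_map h.nodup he he' hocc

theorem SynthShape.mem_bound {M : Lam} {n m : ℕ} {r : Result} {D : Skel}
    (h : SynthShape M n m r D) {e : Entry} (he : e ∈ r.base) :
    e.occ ∈ (fvo (r.base.filter fun e => e.var == 0)).toFinset ↔ e.var = 0 := by
  simp only [List.mem_toFinset, fvo, List.mem_map, List.mem_filter, beq_iff_eq]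
  constructor
  · rintro ⟨e', ⟨he', h0⟩, hocc⟩
    rwa [← h.occ_inj he' he hocc]
  · intro h0
    exact ⟨e, ⟨he, h0⟩, rfl⟩

theorem SynthShape.lam {M : Lam} {n m m' : ℕ} {r r' : Result} {D : Skel}
    (h : SynthShape M n m r D) (hm : m ≤ m')
    (hbase : r'.base = (r.base.filter fun e => e.var != 0).map
      fun e => { e with var := e.var - 1 })
    (hrows : ∀ q ∈ r'.rows, n ≤ q.name ∧ q.name < m')
    (hcpts : ∀ sl ∈ r'.cpts, ∀ p ∈ sl, (n ≤ p.1 ∧ p.1 < m') ∧ ∀ y ∈ p.2, n ≤ y ∧ y < m') :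
    SynthShape (.lam M) n m' r'
      (.lam (fvo (r.base.filter fun e => e.var == 0)).toFinset D) := by
  have hocc : fvo r'.base = fvo (r.base.filter fun e => e.var != 0) := by
    simp [hbase, fvo, Function.comp_def]
  refine ⟨h.le.trans hm, fun y => ?_, ?_, fun y hy => ?_, ⟨fun y hy => ?_, h.lin⟩, fun ρ hρ => ?_,
    nofun, hrows, hcpts⟩
  · rw [hocc]
    simp only [Skel.fv, Finset.mem_sdiff, h.mem_fv]
    constructor
    · rintro ⟨hy, hy'⟩
      obtain ⟨e, he, rfl⟩ := List.mem_map.1 hy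
      rw [h.mem_bound he] at hy'
      exact List.mem_map.2 ⟨e, List.mem_filter.2 ⟨he, by simpa using hy'⟩, rfl⟩
    · intro hy
      obtain ⟨e, he, rfl⟩ := List.mem_map.1 hy
      obtain ⟨he, h0⟩ := List.mem_filter.1 he
      rw [h.mem_bound he]
      exact ⟨List.mem_map_of_mem he, by simpa using h0⟩
  · rw [hocc]
    exact h.nodup.sublist (List.filter_sublist.map _)
  · have := h.leaves y hy
    omega
  · rw [h.mem_fv]
    obtain ⟨e, he, rfl⟩ := List.mem_map.1 (List.mem_toFinset.1 hy)
    exact List.mem_map_of_mem (List.mem_filter.1 he).1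
  · simp only [Skel.er]
    congr 1
    rw [← h.er_eq (fun y => if y ∈ (fvo (r.base.filter fun e => e.var == 0)).toFinset then 0
      else ρ y + 1) fun e he => ?_]
    · congr 1
      funext y
      unfold Skel.lift
      split_ifs <;> rfl
    · simp only [h.mem_bound he]
      split_ifs with h0
      · exact h0.symm
      · have : ρ e.occ = e.var - 1 := by
          have := hρ { e with var := e.var - 1 }
            (hbase ▸ List.mem_map.2 ⟨e, List.mem_filter.2 ⟨he, by simpa using h0⟩, rfl⟩)
          exact this
        omega

theorem EnvFits.of_lam {X : ℕ → ℕ} {w : List (Slice × ℕ)} {a : ℕ} {B : List Entry}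
    {Γ : ℕ → ℕ × Ty}
    (h : EnvFits X w a ((B.filter fun e => e.var != 0).map fun e => { e with var := e.var - 1 }) Γ)
    {e : Entry} (he : e ∈ B) (h0 : e.var ≠ 0) :
    (Γ e.occ).1 + wt (fun sl => sl.hasOcc e.occ) w ≤ a ∧
      (Γ e.occ).2 = Ty.bang^[a - ((Γ e.occ).1 + wt (fun sl => sl.hasOcc e.occ) w)]
        (e.ty.inst X) := by
  have := h { e with var := e.var - 1 }
    (List.mem_map.2 ⟨e, List.mem_filter.2 ⟨he, by simpa using h0⟩, rfl⟩)
  exact this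

theorem EnvFits.level_le {X : ℕ → ℕ} {w : List (Slice × ℕ)} {a : ℕ} {r : Result}
    {Γ : ℕ → ℕ × Ty} {M : Lam} {n m : ℕ} {D : Skel} (hs : SynthShape M n m r D)
    (h : EnvFits X w a r.base Γ) : ∀ y ∈ D.fv, (Γ y).1 ≤ a := by
  intro y hy
  obtain ⟨e, he, rfl⟩ := List.mem_map.1 ((hs.mem_fv y).1 hy)
  have := (h e he).1
  omega

theorem GTy.inst_arr_nil (X : ℕ → ℕ) (Θ Δ : GTy) :
    (GTy.arr [] Θ Δ).inst X = .lolli (Θ.inst X) (Δ.inst X) := rfl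

/-- The bound variable occurs: its occurrences are contracted. -/
theorem synthTyped_lam (X : ℕ → ℕ) {M : Lam} {n m m' : ℕ} {r : Result} {D : Skel} {e : Entry}
    {es : List Entry} {A₃ : List Constr} {R₃ : List Row}
    (hs : SynthShape M n m r D) (ht : SynthTyped X r D fun t => ∀ y, D = .leaf y → t = 0)
    (hB : (r.base.filter fun e => e.var == 0) = e :: es)
    (hA₃ : contract ((e :: es).map Entry.ty) = some A₃) (hR₃ : nameRows A₃ m = some (R₃, m')) :
    SynthShape (.lam M) n m' ⟨.arr [] e.ty r.ty,
        (r.base.filter fun e => e.var != 0).map fun e => { e with var := e.var - 1 },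
        r.rows ++ R₃, r.cpts.filter fun sl => !((e :: es).any fun e' => sl.hasOcc e'.occ)⟩
        (.lam (fvo (r.base.filter fun e => e.var == 0)).toFinset D) ∧
      SynthTyped X ⟨.arr [] e.ty r.ty,
        (r.base.filter fun e => e.var != 0).map fun e => { e with var := e.var - 1 },
        r.rows ++ R₃, r.cpts.filter fun sl => !((e :: es).any fun e' => sl.hasOcc e'.occ)⟩
        (.lam (fvo (r.base.filter fun e => e.var == 0)).toFinset D) fun t => t = 0 := by
  obtain ⟨hm, hconstr, hnames⟩ := nameRows_spec hR₃
  have hle := hs.le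
  refine (fun h => And.intro h ?_) (hs.lam hm rfl ?_ ?_)
  · intro w hw hr a Γ ha hΓ
    have hw' : ∀ p ∈ w, p.1 ∈ r.cpts := fun p hp => (List.mem_filter.1 (hw p hp)).1
    have hA : ∀ c ∈ A₃, c.SatSub X 0 := by
      intro c hc
      rw [← hconstr] at hc
      obtain ⟨q, hq, rfl⟩ := List.mem_map.1 hc
      have := hr q (List.mem_append_right _ hq)
      rwa [wt_eq_zero fun p hp => hs.hasRow_eq_false (.inr (hnames q hq).1) p.1 (hw' p hp)] at this
    obtain ⟨heq, hbang⟩ := contract_inst hA₃ hA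
    have hΓ' : EnvFits X w a r.base (extEnv Γ
        (fvo (r.base.filter fun e => e.var == 0)).toFinset a (e.ty.inst X)) := by
      intro e' he'
      by_cases h0 : e'.var = 0
      · have hmem : e' ∈ e :: es := hB ▸ List.mem_filter.2 ⟨he', by simpa using h0⟩
        -- Slices meeting the bound variable have been discarded, so its occurrences can be declared
        -- at level `a`, that of the abstraction, without any added modality.
        rw [wt_eq_zero (w := w)]
        · simp only [extEnv, (hs.mem_bound he').2 h0, if_true, Nat.add_zero, Nat.sub_self]
          exact ⟨le_rfl, (heq _ (List.mem_map_of_mem (f := Entry.ty) hmem)).symm⟩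
        · intro p hp
          have := (List.mem_filter.1 (hw p hp)).2
          simp only [Bool.not_eq_true', List.any_eq_false] at this
          simpa using this e' hmem
      · simp only [extEnv, hs.mem_bound he', h0, if_false]
        exact hΓ.of_lam he' h0
    obtain ⟨t, A₀, hv, hA₀, hD⟩ := ht w hw' (fun q hq => hr q (List.mem_append_left _ hq)) a _ ha hΓ'
    refine ⟨0, _, rfl, GTy.inst_arr_nil X _ _, .lam (hΓ.level_le h) hD ?_ ?_ fun hcard => hbang ?_⟩
    · rw [hA₀, ← Function.iterate_add_apply]
      rfl
    · intro y hy
      rw [hv y hy]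
    · have := hcard.trans (List.toFinset_card_le _)
      rw [hB] at this
      rintro e
      simp only [List.map_eq_nil_iff] at e
      subst e
      simp [fvo] at this
  · intro q hq
    rcases List.mem_append.1 hq with hq | hq
    · have := hs.rows q hq
      omega
    · have := hnames q hq
      omega
  · intro sl hsl p hp
    have := hs.cpts sl (List.mem_filter.1 hsl).1 p hp
    refine ⟨by omega, fun y hy => ?_⟩
    have := this.2 y hy
    omega

theorem filter_var_ne_zero {B : List Entry} (hB : (B.filter fun e => e.var == 0) = []) :
    (B.filter fun e => e.var != 0) = B := by
  rw [List.filter_eq_nil_iff] at hB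
  exact List.filter_eq_self.2 fun e he => by simpa using hB e he

/-- The bound variable does not occur; the body is or is not an application. -/
theorem synthTyped_lam_nil (X : ℕ → ℕ) {M : Lam} {n m m' : ℕ} {r r' : Result} {D : Skel}
    {j : ℕ} {Θ Δ : GTy} {b : Bool}
    (hs : SynthShape M n m r D) (ht : SynthTyped X r D fun t => ∀ y, D = .leaf y → t = 0)
    (hB : (r.base.filter fun e => e.var == 0) = []) (hm : m ≤ j) (hm' : j < m')
    (hty : r'.ty = .arr [] Θ Δ)
    (hbase : r'.base = (r.base.filter fun e => e.var != 0).map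
      fun e => { e with var := e.var - 1 })
    (hrows : ∀ q ∈ r.rows, q ∈ r'.rows)
    (hrows' : ∀ q ∈ r'.rows, q ∈ r.rows ∨ q.name = j)
    (hcpts : r'.cpts = if b then r.cpts ++ [[(j, fvo r'.base)]] else r.cpts)
    (hΔ : ∀ w k, RowsSat X w r'.rows → (b = false → k = 0) →
      wt (fun sl => sl.hasRow j) w = k → r.ty.inst X = Ty.bang^[k] (Δ.inst X)) :
    SynthShape (.lam M) n m' r' (.lam (fvo (r.base.filter fun e => e.var == 0)).toFinset D) ∧
      SynthTyped X r' (.lam (fvo (r.base.filter fun e => e.var == 0)).toFinset D)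
        fun t => t = 0 := by
  have hle := hs.le
  have hvar : ∀ e ∈ r.base, e.var ≠ 0 := fun e he h0 => by
    rw [List.filter_eq_nil_iff] at hB
    exact hB e he (by simpa using h0)
  have hocc : fvo r'.base = fvo r.base := by
    simp [hbase, filter_var_ne_zero hB, fvo, Function.comp_def]
  refine (fun h => And.intro h ?_) (hs.lam (by omega) hbase ?_ ?_)
  · intro w hw hr a Γ ha hΓ
    rw [hcpts] at hw
    obtain ⟨w', k, hw', hk, hφ⟩ := exists_wt_snoc hw
    have htot := hφ fun _ => true
    simp only [if_true] at htot
    have hj : wt (fun sl => sl.hasRow j) w = k := by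
      rw [hφ, wt_eq_zero fun p hp => hs.hasRow_eq_false (.inr hm) p.1 (hw' p hp)]
      simp [Slice.hasRow]
    have hsub := hΔ w k hr hk hj
    have hrow : RowsSat X w' r.rows := by
      intro q hq
      have := hr q (hrows q hq)
      rw [hφ, if_neg] at this
      · exact this
      · have := hs.rows q hq
        rw [Slice.hasRow_eq_false]
        · simp
        · simp only [List.mem_singleton, forall_eq]
          omega
    -- With a critical point, `k` boxes close at the root of the body, which is hence considered
    -- from level `a - k`. All its free occurrences belong to that slice, so their modalities are
    -- unaffected; without one, `k` is 0.
    have hΓ' : EnvFits X w' (a - k) r.base (extEnv Γ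
        (fvo (r.base.filter fun e => e.var == 0)).toFinset a (Θ.inst X)) := by
      intro e he
      have := (hbase ▸ hΓ).of_lam he (hvar e he)
      rw [hφ, if_pos] at this
      · simp only [extEnv, hs.mem_bound he, hvar e he, if_false]
        refine ⟨by omega, ?_⟩
        rw [this.2]
        congr 1
        omega
      · have hmem : e.occ ∈ fvo r.base := List.mem_map_of_mem he
        simp [Slice.hasOcc, hocc, hmem]
    obtain ⟨t, A₀, hv, hA₀, hD⟩ := ht w' hw' hrow (a - k) _ (by omega) hΓ'
    refine ⟨0, _, rfl, hty ▸ GTy.inst_arr_nil X _ _, .lam (hΓ.level_le h) hD ?_ ?_ ?_⟩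
    · rw [Function.iterate_add_apply, ← hA₀, hsub, ← Function.iterate_add_apply]
      congr 1
      omega
    · intro y hy
      rw [hv y hy]
      omega
    · simp [hB, fvo]
  · intro q hq
    rcases hrows' q hq with hq | hq
    · have := hs.rows q hq
      omega
    · omega
  · intro sl hsl p hp
    have hold : sl ∈ r.cpts → (n ≤ p.1 ∧ p.1 < m') ∧ ∀ y ∈ p.2, n ≤ y ∧ y < m' := by
      intro hsl
      have := hs.cpts sl hsl p hp
      refine ⟨by omega, fun y hy => ?_⟩
      have := this.2 y hy
      omega
    rw [hcpts] at hsl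
    split_ifs at hsl
    · rcases List.mem_append.1 hsl with hsl | hsl
      · exact hold hsl
      · rw [List.mem_singleton.1 hsl, List.mem_singleton] at hp
        subst hp
        refine ⟨by simp only; omega, fun y hy => ?_⟩
        have := hs.occ_range y (hocc ▸ hy)
        omega
    · exact hold hsl

theorem synthLam_spec (X : ℕ → ℕ) {σ : STy} {M : Lam} {n m k : ℕ} {r r' : Result} {D : Skel}
    (hs : SynthShape M n m r D) (ht : SynthTyped X r D fun t => t = 0)
    (h : synthLam σ M r m = some (r', k)) :
    ∃ D', SynthShape (.lam M) n k r' D' ∧ SynthTyped X r' D' fun t => t = 0 := by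
  simp only [synthLam, Fresh.bind_eq_some] at h
  obtain ⟨r₁, m₁, h₁, h⟩ := h
  obtain ⟨hs₁, -, ht₁⟩ := boxing_spec X hs ht h₁
  cases hB : r₁.base.filter fun e => e.var == 0 with
  | cons e es =>
    simp only [hB, Fresh.bind_eq_some, Fresh.pure_eq_some, Fresh.lift_eq_some] at h
    obtain ⟨A₃, _, ⟨hA₃, rfl⟩, R₃, _, hR₃, rfl, rfl⟩ := h
    exact ⟨_, synthTyped_lam X hs₁ ht₁ hB hA₃ hR₃⟩
  | nil =>
    simp only [hB, Fresh.bind_eq_some] at h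
    obtain ⟨Θ, m₂, hΘ, h⟩ := h
    have hle := process_lt hΘ
    split_ifs at h with hM
    · simp only [Fresh.bind_eq_some, Fresh.pure_eq_some, fresh_eq_some] at h
      obtain ⟨_, _, ⟨rfl, rfl⟩, _, _, ⟨rfl, rfl⟩, rfl, rfl⟩ := h
      refine ⟨_, synthTyped_lam_nil X (b := true) (j := m₂ + 1) (Θ := Θ) (Δ := r₁.ty.setExpo m₂)
        hs₁ ht₁ hB (by omega) (by omega) rfl rfl ?_ ?_ rfl ?_⟩
      · intro q hq
        exact List.mem_append_left _ hq
      · intro q hq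
        rcases List.mem_append.1 hq with hq | hq
        · exact .inl hq
        · rw [List.mem_singleton.1 hq]
          exact .inr rfl
      · intro w k hr _ hk
        have := hr _ (List.mem_append_right _ (List.mem_singleton_self _))
        simp only [hk, Constr.SatSub] at this
        exact GTy.inst_eq_setExpo X m₂ k r₁.ty (by simpa [Expo.eval] using this)
    · simp only [Fresh.pure_eq_some] at h
      obtain ⟨rfl, rfl⟩ := h
      -- Here `j` is a dummy: without a critical point no row and no slice carries this name.
      refine ⟨_, synthTyped_lam_nil X (b := false) (j := m₁) (Θ := Θ) (Δ := r₁.ty)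
        hs₁ ht₁ hB le_rfl hle rfl rfl (fun _ hq => hq) (fun _ hq => .inl hq) rfl ?_⟩
      intro w k _ hk _
      rw [hk rfl]
      rfl

/-! ### Applications -/

theorem SynthShape.app {M N : Lam} {n m m' k : ℕ} {r₁ r₂ r : Result} {D E : Skel}
    (h₁ : SynthShape M n m r₁ D) (h₂ : SynthShape N m m' r₂ E) (hk : m' ≤ k)
    (hbase : r.base = r₁.base ++ r₂.base)
    (hrows : ∀ q ∈ r.rows, n ≤ q.name ∧ q.name < k)
    (hcpts : ∀ sl ∈ r.cpts, ∀ p ∈ sl, (n ≤ p.1 ∧ p.1 < k) ∧ ∀ y ∈ p.2, n ≤ y ∧ y < k) :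
    SynthShape (.app M N) n k r (.app D E) := by
  have hle₁ := h₁.le
  have hle₂ := h₂.le
  have hocc : fvo r.base = fvo r₁.base ++ fvo r₂.base := by simp [hbase, fvo]
  refine ⟨by omega, fun y => ?_, ?_, fun y hy => ?_, ⟨?_, h₁.lin, h₂.lin⟩, fun ρ hρ => ?_, nofun,
    hrows, hcpts⟩
  · rw [hocc, List.mem_append, ← h₁.mem_fv, ← h₂.mem_fv]
    exact Finset.mem_union
  · rw [hocc]
    refine h₁.nodup.append h₂.nodup fun y hy hy' => ?_
    have := h₁.occ_range y hy
    have := h₂.occ_range y hy'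
    omega
  · rcases Finset.mem_union.1 hy with hy | hy
    · have := h₁.leaves y hy
      omega
    · have := h₂.leaves y hy
      omega
  · rw [Finset.disjoint_left]
    intro y hy hy'
    have := h₁.leaves y hy
    have := h₂.leaves y hy'
    omega
  · simp only [Skel.er]
    rw [h₁.er_eq ρ fun e he => hρ e (hbase ▸ List.mem_append_left _ he),
      h₂.er_eq ρ fun e he => hρ e (hbase ▸ List.mem_append_right _ he)]

/-- The part of an environment and a system of weights that concerns an immediate subterm with
a critical point, named `j`, at its root. -/
theorem EnvFits.of_snoc {X : ℕ → ℕ} {w w' : List (Slice × ℕ)} {a k j : ℕ} {B : List Entry}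
    {Γ : ℕ → ℕ × Ty} (hk : k ≤ a)
    (h : ∀ e ∈ B, wt (fun sl => sl.hasOcc e.occ) w =
      wt (fun sl => sl.hasOcc e.occ) w' + if Slice.hasOcc [(j, fvo B)] e.occ then k else 0)
    (hΓ : EnvFits X w a B Γ) : EnvFits X w' (a - k) B Γ := by
  intro e he
  have h' := hΓ e he
  have hmem : e.occ ∈ fvo B := List.mem_map_of_mem he
  rw [h e he, if_pos (by simpa [Slice.hasOcc] using hmem)] at h'
  refine ⟨by omega, ?_⟩
  rw [h'.2]
  congr 1
  omega

/-- The four application cases at once: `b₁` and `b₂` tell whether the function and the argument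
have a critical point at the root. Its row is `j`, for the exponent of the function type,
respectively `i`, for the outermost exponents in the unification. -/
theorem synthTyped_app (X : ℕ → ℕ) {M N : Lam} {n m m' k i j : ℕ} {r₁ r₂ r : Result} {D E : Skel}
    {ns : Expo} {Θ Γ : GTy} {R : List Row} {b₁ b₂ : Bool}
    (h₁ : SynthShape M n m r₁ D) (ht₁ : SynthTyped X r₁ D fun t => t = 0)
    (h₂ : SynthShape N m m' r₂ E) (ht₂ : SynthTyped X r₂ E fun t => ∀ y, E = .leaf y → t = 0)
    (hty₁ : r₁.ty = .arr ns Θ Γ)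
    (hi : m' ≤ i) (hj : i < j) (hjk : j < k) (hR : ∀ q ∈ R, m' ≤ q.name ∧ q.name < j)
    (hty : r.ty = Γ) (hbase : r.base = r₁.base ++ r₂.base)
    (hrows : r.rows = r₁.rows ++ r₂.rows ++ R ++ [⟨j, .eqZero ns []⟩])
    (hcpts : r.cpts = prodUnion (if b₁ then r₁.cpts ++ [[(j, fvo r₁.base)]] else r₁.cpts)
      (if b₂ then r₂.cpts ++ [[(i, fvo r₂.base)]] else r₂.cpts))
    (hunify : ∀ k, (b₂ = false → k = 0) → (∀ q ∈ R, q.constr.SatSub X (if q.name = i then k else 0)) →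
      r₂.ty.inst X = Ty.bang^[k] (Θ.inst X)) :
    SynthShape (.app M N) n k r (.app D E) ∧ SynthTyped X r (.app D E) fun t => t = 0 := by
  have hle₁ := h₁.le
  have hle₂ := h₂.le
  set C₁ := if b₁ then r₁.cpts ++ [[(j, fvo r₁.base)]] else r₁.cpts with hC₁
  set C₂ := if b₂ then r₂.cpts ++ [[(i, fvo r₂.base)]] else r₂.cpts with hC₂
  have range₁ : ∀ sl ∈ C₁, ∀ p ∈ sl, ((n ≤ p.1 ∧ p.1 < m) ∨ p.1 = j) ∧
      ∀ y ∈ p.2, n ≤ y ∧ y < m := by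
    intro sl hsl p hp
    have hold : sl ∈ r₁.cpts → ((n ≤ p.1 ∧ p.1 < m) ∨ p.1 = j) ∧ ∀ y ∈ p.2, n ≤ y ∧ y < m :=
      fun hsl => ⟨.inl (h₁.cpts sl hsl p hp).1, (h₁.cpts sl hsl p hp).2⟩
    rw [hC₁] at hsl
    split_ifs at hsl
    · rcases List.mem_append.1 hsl with hsl | hsl
      · exact hold hsl
      · rw [List.mem_singleton.1 hsl, List.mem_singleton] at hp
        subst hp
        exact ⟨.inr rfl, h₁.occ_range⟩
    · exact hold hsl
  have range₂ : ∀ sl ∈ C₂, ∀ p ∈ sl, ((m ≤ p.1 ∧ p.1 < m') ∨ p.1 = i) ∧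
      ∀ y ∈ p.2, m ≤ y ∧ y < m' := by
    intro sl hsl p hp
    have hold : sl ∈ r₂.cpts → ((m ≤ p.1 ∧ p.1 < m') ∨ p.1 = i) ∧ ∀ y ∈ p.2, m ≤ y ∧ y < m' :=
      fun hsl => ⟨.inl (h₂.cpts sl hsl p hp).1, (h₂.cpts sl hsl p hp).2⟩
    rw [hC₂] at hsl
    split_ifs at hsl
    · rcases List.mem_append.1 hsl with hsl | hsl
      · exact hold hsl
      · rw [List.mem_singleton.1 hsl, List.mem_singleton] at hp
        subst hp
        exact ⟨.inr rfl, h₂.occ_range⟩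
    · exact hold hsl
  refine (fun h => And.intro h ?_) (h₁.app h₂ (by omega) hbase ?_ ?_)
  · intro w hw hr a Δ ha hΔ
    rw [hcpts] at hw
    rw [hrows] at hr
    obtain ⟨wM, wN, hwM, hwN, htM, htN, hφ⟩ := exists_wt_prodUnion hw
    obtain ⟨w₁, k₁, hw₁, hk₁, hφ₁⟩ := exists_wt_snoc hwM
    obtain ⟨w₂, k₂, hw₂, hk₂, hφ₂⟩ := exists_wt_snoc hwN
    have htot₁ := hφ₁ fun _ => true
    have htot₂ := hφ₂ fun _ => true
    simp only [if_true] at htot₁ htot₂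
    -- Names below `m` and the name `j` occur only in slices of the function side, those from `m` up
    -- to `j` only in slices of the argument side; each weight thus reduces to one projection.
    have row₁ : ∀ x, (x < m ∨ x = j) → wt (fun sl => sl.hasRow x) w =
        wt (fun sl => sl.hasRow x) w₁ + if j = x then k₁ else 0 := by
      intro x hx
      rw [((hφ _ (Slice.hasRow_append x)).1 fun sl hsl => Slice.hasRow_eq_false fun p hp e => by
        have := (range₂ sl hsl p hp).1
        omega), hφ₁]
      simp [Slice.hasRow]
    have row₂ : ∀ x, m ≤ x → x < j → wt (fun sl => sl.hasRow x) w =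
        wt (fun sl => sl.hasRow x) w₂ + if i = x then k₂ else 0 := by
      intro x hx hx'
      rw [((hφ _ (Slice.hasRow_append x)).2 fun sl hsl => Slice.hasRow_eq_false fun p hp e => by
        have := (range₁ sl hsl p hp).1
        omega), hφ₂]
      simp [Slice.hasRow]
    have hrow₁ : RowsSat X w₁ r₁.rows := by
      intro q hq
      have hq' := h₁.rows q hq
      have := hr q (by simp [hq])
      rwa [row₁ _ (.inl hq'.2), if_neg (by omega)] at this
    have hrow₂ : RowsSat X w₂ r₂.rows := by
      intro q hq
      have hq' := h₂.rows q hq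
      have := hr q (by simp [hq])
      rwa [row₂ _ hq'.1 (by omega), if_neg (by omega)] at this
    have hrow : ∀ q ∈ R, q.constr.SatSub X (if q.name = i then k₂ else 0) := by
      intro q hq
      have hq' := hR q hq
      have := hr q (by simp [hq])
      rw [row₂ _ (by omega) hq'.2,
        wt_eq_zero fun p hp => h₂.hasRow_eq_false (.inr hq'.1) p.1 (hw₂ p hp), Nat.zero_add] at this
      simpa only [eq_comm] using this
    -- The row `e = 0`, shifted by the weight of its critical point, reads `e = k₁`: the modalities
    -- on the function type are exactly those used up by closing `k₁` boxes at the function part.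
    have hns : Expo.eval X ns = k₁ := by
      have := hr ⟨j, .eqZero ns []⟩ (by simp)
      rw [row₁ _ (.inr rfl), wt_eq_zero fun p hp =>
        h₁.hasRow_eq_false (.inr (show m ≤ j by omega)) p.1 (hw₁ p hp)] at this
      simpa [Constr.SatSub, Expo.eval] using this
    have hΔ₁ : EnvFits X w₁ (a - k₁) r₁.base Δ := by
      refine EnvFits.of_snoc (by omega) (j := j) (w := w) (fun e he => ?_)
        fun e he => hΔ e (hbase ▸ List.mem_append_left _ he)
      have hocc := h₁.occ_range _ (List.mem_map_of_mem (f := Entry.occ) he)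
      rw [((hφ _ (Slice.hasOcc_append e.occ)).1 fun sl hsl =>
        Slice.hasOcc_eq_false fun p hp z hz hze => by
          have := (range₂ sl hsl p hp).2 z hz
          omega), hφ₁]
    have hΔ₂ : EnvFits X w₂ (a - k₂) r₂.base Δ := by
      refine EnvFits.of_snoc (by omega) (j := i) (w := w) (fun e he => ?_)
        fun e he => hΔ e (hbase ▸ List.mem_append_right _ he)
      have hocc := h₂.occ_range _ (List.mem_map_of_mem (f := Entry.occ) he)
      rw [((hφ _ (Slice.hasOcc_append e.occ)).2 fun sl hsl =>
        Slice.hasOcc_eq_false fun p hp z hz hze => by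
          have := (range₁ sl hsl p hp).2 z hz
          omega), hφ₂]
    obtain ⟨_, A₁, rfl, hA₁, hD⟩ := ht₁ w₁ hw₁ hrow₁ (a - k₁) Δ (by omega) hΔ₁
    obtain ⟨t, A₂, hv, hA₂, hE⟩ := ht₂ w₂ hw₂ hrow₂ (a - k₂) Δ (by omega) hΔ₂
    refine ⟨0, Γ.inst X, rfl, by rw [hty]; rfl, .app (hΔ.level_le h) hD (B := Θ.inst X) ?_ hE
      ?_ (fun y _ => by omega) fun y hy => by rw [hv y hy]; omega⟩
    · have e : A₁ = Ty.bang^[k₁] (.lolli (Θ.inst X) (Γ.inst X)) := by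
        rw [← hns]
        rw [hty₁] at hA₁
        exact hA₁.symm
      rw [e, ← Function.iterate_add_apply]
      congr 1
      omega
    · rw [Function.iterate_add_apply, ← hA₂, hunify k₂ hk₂ hrow, ← Function.iterate_add_apply]
      congr 1
      omega
  · intro q hq
    simp only [hrows, List.mem_append, List.mem_singleton] at hq
    rcases hq with ((hq | hq) | hq) | rfl
    · have := h₁.rows q hq
      omega
    · have := h₂.rows q hq
      omega
    · have := hR q hq
      omega
    · simp only
      omega
  · intro sl hsl p hp
    have key₁ : ∀ s ∈ C₁, p ∈ s → (n ≤ p.1 ∧ p.1 < k) ∧ ∀ y ∈ p.2, n ≤ y ∧ y < k := by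
      intro s hs hp
      have := range₁ s hs p hp
      refine ⟨by omega, fun y hy => ?_⟩
      have := this.2 y hy
      omega
    have key₂ : ∀ s ∈ C₂, p ∈ s → (n ≤ p.1 ∧ p.1 < k) ∧ ∀ y ∈ p.2, n ≤ y ∧ y < k := by
      intro s hs hp
      have := range₂ s hs p hp
      refine ⟨by omega, fun y hy => ?_⟩
      have := this.2 y hy
      omega
    rw [hcpts] at hsl
    rcases mem_prodUnion hsl with hs | hs | ⟨s, hs, t, ht, rfl⟩
    · exact key₁ _ hs hp
    · exact key₂ _ hs hp
    · rcases List.mem_append.1 hp with hp | hp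
      exacts [key₁ s hs hp, key₂ t ht hp]

theorem unify_nameRows_spec {Θ Δ : GTy} {A : List Constr} {R : List Row} {n m : ℕ}
    (hA : unify Θ Δ = some A) (hR : nameRows A n = some (R, m)) :
    ∃ c R', R = ⟨n, c⟩ :: R' ∧ n < m ∧ (∀ q ∈ R, n ≤ q.name ∧ q.name < m) ∧
      ∀ X k, (∀ q ∈ R, q.constr.SatSub X (if q.name = n then k else 0)) →
        Θ.inst X = Ty.bang^[k] (Δ.inst X) := by
  have hrange := (nameRows_spec hR).2.2
  obtain ⟨A', rfl, hinst⟩ := unify_spec hA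
  simp only [nameRows, Fresh.bind_eq_some, Fresh.pure_eq_some, fresh_eq_some] at hR
  obtain ⟨_, _, ⟨rfl, rfl⟩, R', _, hR', rfl, rfl⟩ := hR
  obtain ⟨hle, hconstr, hnames⟩ := nameRows_spec hR'
  refine ⟨_, R', rfl, hle, hrange, fun X k h => hinst X k ?_ fun c hc => ?_⟩
  · have := h _ List.mem_cons_self
    rwa [if_pos rfl] at this
  · rw [← hconstr] at hc
    obtain ⟨q, hq, rfl⟩ := List.mem_map.1 hc
    have := h q (List.mem_cons_of_mem _ hq)
    rwa [if_neg (by have := hnames q hq; omega)] at this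

theorem synthApp_spec (X : ℕ → ℕ) {M N : Lam} {n m m' k : ℕ} {r₁ r₂ r : Result} {D E : Skel}
    (h₁ : SynthShape M n m r₁ D) (ht₁ : SynthTyped X r₁ D fun t => t = 0)
    (h₂ : SynthShape N m m' r₂ E) (ht₂ : SynthTyped X r₂ E fun t => t = 0)
    (h : synthApp M N r₁ r₂ m' = some (r, k)) :
    ∃ D', SynthShape (.app M N) n k r D' ∧ SynthTyped X r D' fun t => t = 0 := by
  unfold synthApp at h
  cases hty : r₁.ty with
  | base e =>
    rw [hty] at h
    exact absurd h (by simp [failure, StateT.failure])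
  | arr ns Θ Γ =>
    simp only [hty, Fresh.bind_eq_some] at h
    obtain ⟨r₃, m₁, hbox, h⟩ := h
    obtain ⟨h₃, -, ht₃⟩ := boxing_spec X h₂ ht₂ hbox
    cases hN : N.isApp
    all_goals
      simp only [hN, if_true, if_false, Bool.false_eq_true, Fresh.bind_eq_some,
        Fresh.pure_eq_some, Fresh.lift_eq_some, fresh_eq_some] at h
      obtain ⟨A₄, _, ⟨hA₄, rfl⟩, R₄, m₃, hR₄, _, _, ⟨rfl, rfl⟩, rfl, rfl⟩ := h
      obtain ⟨c, R', rfl, hlt, hR, hinst⟩ := unify_nameRows_spec hA₄ hR₄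
    · refine ⟨_, synthTyped_app X (b₁ := M.isApp) (b₂ := false) h₁ ht₁ h₃ ht₃ hty le_rfl hlt
        (Nat.lt_succ_self _) hR rfl rfl rfl rfl fun k hk0 hk => ?_⟩
      -- Without a critical point there is no shift, and the order of unification is immaterial.
      -- When the argument is an application its type comes first, so that the shift falls on its
      -- side.
      obtain rfl := hk0 rfl
      exact (hinst X 0 hk).symm
    · exact ⟨_, synthTyped_app X (b₁ := M.isApp) (b₂ := true) h₁ ht₁ h₃ ht₃ hty le_rfl hlt
        (Nat.lt_succ_self _) hR rfl rfl rfl rfl fun k _ hk => hinst X k hk⟩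

/-! ### Soundness -/

theorem synth_spec (X : ℕ → ℕ) {Γ : List STy} {M : Lam} {σ : STy} (d : SDer Γ M σ) {n m : ℕ}
    {r : Result} (h : synth d n = some (r, m)) :
    ∃ D, SynthShape M n m r D ∧ SynthTyped X r D fun t => t = 0 := by
  induction d generalizing n m r with
  | var i hi => exact synthVar_spec X h
  | lam d ih =>
    simp only [synth, Fresh.bind_eq_some] at h
    obtain ⟨r₁, m₁, h₁, h⟩ := h
    obtain ⟨D, hs, ht⟩ := ih h₁
    exact synthLam_spec X hs ht h
  | app d e ihd ihe =>
    simp only [synth, Fresh.bind_eq_some] at h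
    obtain ⟨r₁, m₁, h₁, r₂, m₂, h₂, h⟩ := h
    obtain ⟨D, hs₁, ht₁⟩ := ihd h₁
    obtain ⟨E, hs₂, ht₂⟩ := ihe h₂
    exact synthApp_spec X hs₁ ht₁ hs₂ ht₂ h

/-- The contraction constraints give exactly what identifying free occurrences needs: one common
type per variable, modal as soon as the variable has two occurrences. -/
theorem contractBase_spec {X : ℕ → ℕ} {B : List Entry} {xs : List ℕ} {B' : List (ℕ × GTy)}
    {A : List Constr} (h : contractBase B xs = some (B', A)) (hA : ∀ c ∈ A, c.SatSub X 0) :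
    (∀ e ∈ B, e.var ∈ xs → instBase X B' e.var = some (e.ty.inst X)) ∧
      ∀ e ∈ B, ∀ e' ∈ B, e.var ∈ xs → e ≠ e' → e.var = e'.var →
        ∃ C, e.ty.inst X = .bang C := by
  induction xs generalizing B' A with
  | nil => simp
  | cons x xs ih =>
    simp only [contractBase, Option.bind_eq_bind, Option.bind_eq_some_iff, Option.some.injEq,
      Prod.mk.injEq] at h
    obtain ⟨A₁, h₁, ⟨B₂, A₂⟩, h₂, rfl, rfl⟩ := h
    obtain ⟨ih₁, ih₂⟩ := ih h₂ fun c hc => hA c (List.mem_append_right _ hc)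
    cases hB : B.filter fun e => e.var == x with
    | nil =>
      have hne : ∀ e ∈ B, e.var ≠ x := fun e he h => by
        rw [List.filter_eq_nil_iff] at hB
        exact hB e he (by simpa using h)
      refine ⟨fun e he hx => ?_, fun e he e' he' hx => ?_⟩
      · simpa [hB] using ih₁ e he (List.mem_of_ne_of_mem (hne e he) hx)
      · exact ih₂ e he e' he' (List.mem_of_ne_of_mem (hne e he) hx)
    | cons e₀ es =>
      rw [hB] at h₁
      obtain ⟨heq, hbang⟩ := contract_inst h₁ fun c hc => hA c (List.mem_append_left _ hc)
      have hmem : ∀ e ∈ B, e.var = x → e ∈ e₀ :: es := fun e he hx =>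
        hB ▸ List.mem_filter.2 ⟨he, by simpa using hx⟩
      refine ⟨fun e he hx => ?_, fun e he e' he' hx hne hee => ?_⟩
      · by_cases hex : e.var = x
        · have := heq _ (List.mem_map_of_mem (f := Entry.ty) (hmem e he hex))
          simp [instBase, hex, this]
        · have := ih₁ e he (List.mem_of_ne_of_mem hex hx)
          have hex' : (e.var == x) = false := by simpa using hex
          simpa [instBase, hB, List.lookup, hex'] using this
      · by_cases hex : e.var = x
        · rw [heq _ (List.mem_map_of_mem (f := Entry.ty) (hmem e he hex))]
          refine hbang fun hnil => hne ?_
          rw [List.map_eq_nil_iff] at hnil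
          have h₁ := hmem e he hex
          have h₂ := hmem e' he' (hee ▸ hex)
          rw [hnil, List.mem_singleton] at h₁ h₂
          rw [h₁, h₂]
        · exact ih₂ e he e' he' (List.mem_of_ne_of_mem hex hx) hne hee

theorem find?_occ {B : List Entry} (h : (fvo B).Nodup) {e : Entry} (he : e ∈ B) :
    B.find? (fun e' => e'.occ == e.occ) = some e := by
  cases hf : B.find? (fun e' => e'.occ == e.occ) with
  | none =>
    rw [List.find?_eq_none] at hf
    exact absurd (hf e he) (by simp)
  | some e' =>
    have h₁ := List.find?_some hf
    rw [List.inj_on_of_nodup_map h (List.mem_of_find?_eq_some hf) he (by simpa using h₁)]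

end EAL

open EAL in
theorem mainTheorem5 {Γ : List EAL.STy} {M : EAL.Lam} {σ : EAL.STy} (d : EAL.SDer Γ M σ)
    (Θ : EAL.GTy) (B : List (ℕ × EAL.GTy)) (A : List EAL.Constr)
    (hS : EAL.typeSynthesis d = some (Θ, B, A))
    (X : ℕ → ℕ) (hX : EAL.IsSolution X A) :
    ∃ P : EAL.EATerm, P.Candidate ∧ P.star = M ∧
      EAL.NEAL (EAL.instBase X B) P (Θ.inst X) := by
  simp only [typeSynthesis, Option.bind_eq_bind, Option.bind_eq_some_iff, Option.some.injEq,
    Prod.mk.injEq] at hS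
  obtain ⟨⟨r, k⟩, hr, ⟨B', A'⟩, hB, rfl, rfl, rfl⟩ := hS
  obtain ⟨r₀, m, h₀, hbox⟩ := Fresh.bind_eq_some.1 hr
  obtain ⟨D, hs₀, ht₀⟩ := synth_spec X d h₀
  obtain ⟨hs, -, ht⟩ := boxing_spec X hs₀ ht₀ hbox
  obtain ⟨hbase, hbang⟩ := contractBase_spec (X := X) hB fun c hc =>
    Constr.satSub_zero.2 (hX c (List.mem_append_right _ hc))
  have hvar : ∀ e ∈ r.base, e.var ∈ (r.base.map Entry.var).dedup := fun e he =>
    List.mem_dedup.2 (List.mem_map_of_mem he)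
  -- Environment and renaming are read off from the base by occurrence name; their default values
  -- concern names that are not free in the skeleton.
  let entry : ℕ → Option Entry := fun y => r.base.find? fun e => e.occ == y
  let Δ : ℕ → ℕ × Ty := fun y => (0, ((entry y).map fun e => e.ty.inst X).getD .o)
  let ρ : ℕ → ℕ := fun y => ((entry y).map Entry.var).getD 0
  have hΔ : ∀ e ∈ r.base, Δ e.occ = (0, e.ty.inst X) := fun e he => by
    simp [Δ, entry, find?_occ hs.nodup he]
  have hρ : ∀ e ∈ r.base, ρ e.occ = e.var := fun e he => by
    simp [ρ, entry, find?_occ hs.nodup he]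
  -- No further boxing takes place, so the weights are empty, the level is 0 and the rows are
  -- unshifted: they are the constraints that `X` solves.
  obtain ⟨t, C, hv, hC, hD⟩ := ht [] (by simp) (fun q hq => Constr.satSub_zero.2
      (hX _ (List.mem_append_left _ (List.mem_map_of_mem hq)))) 0 Δ le_rfl fun e he => by
    rw [hΔ e he]
    exact ⟨le_rfl, rfl⟩
  rw [Nat.zero_add] at hD
  -- The occurrences of each free variable are merged by contractions outside all boxes.
  obtain ⟨P, hP, -⟩ := exists_realizes_of_injOn (D := D) (Γ := Δ) (T := Ty.bang^[t] C)
    (fun ρ' hρ' => by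
      obtain ⟨P, hP, hPc, -⟩ := hD.exists_realizes D.len t le_rfl hs.lin (fun _ _ => rfl) hv hρ'
      exact ⟨P, hP, hPc⟩) ρ (by
      intro y hy z hz hyz e
      obtain ⟨e₁, he₁, rfl⟩ := List.mem_map.1 ((hs.mem_fv y).1 hy)
      obtain ⟨e₂, he₂, rfl⟩ := List.mem_map.1 ((hs.mem_fv z).1 hz)
      rw [hρ _ he₁, hρ _ he₂] at e
      have h₁ := hbase e₁ he₁ (hvar e₁ he₁)
      have h₂ := hbase e₂ he₂ (hvar e₂ he₂)
      rw [← e, h₁] at h₂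
      rw [hΔ _ he₁, hΔ _ he₂]
      exact ⟨Option.some.inj h₂, hbang e₁ he₁ e₂ he₂ (hvar e₁ he₁) (fun h => hyz (h ▸ rfl)) e⟩)
  refine ⟨P, hP.candidate, hP.star_eq.trans (hs.er_eq ρ hρ), ?_⟩
  rw [hC]
  refine hP.typed _ fun y hy => ?_
  obtain ⟨e, he, rfl⟩ := List.mem_map.1 ((hs.mem_fv y).1 hy)
  rw [hρ e he, hΔ e he]
  exact hbase e he (hvar e he)
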